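/- Let a signature $\Sigma$ be a finite set of function symbols with arities, and consider terms over $\Sigma$ and a countably infinite set of variables. A rewrite rule $l\to r$ over $\Sigma$ is a pair of terms over $\Sigma$ such that $l$ is not a variable and every variable of $r$ occurs in $l$; a term rewrite system (TRS) $R$ over $\Sigma$ is a finite set of rewrite rules. Write $s\to_{R,p}t$ if, for some $l\to r\in R$ and some substitution $\sigma$, the subterm $s|_p$ of $s$ at position $p$ is $\sigma(l)$ and $t$ is $s$ with that subterm replaced by $\sigma(r)$; write $s\to_R t$ if $s\to_{R,p}t$ for some $p$. $R$ is *right-shallow* if in each right-hand side all variables occur at depth $0$ or $1$, and *right-linear* if in each right-hand side every variable occurs at most once. The height of a variable or constant is $0$, and the height of $f(t_1,\dots,t_m)$ with $m\ge 1$ is one more than the maximal height of the $t_i$. A *permutative theory* $E$ over $\Sigma$ is a finite set of rewrite rules $l\to r$ over $\Sigma$, closed under exchanging the two sides, such that $l$ and $r$ are linear (every variable occurs at most once in $l$ and at most once in $r$), have the same height, which is at most $1$, and contain the same variables. Write $s\to_{R/E}t$ if $s\to_E^*u\to_R v\to_E^*t$ for some $u,v$, and call a term an $R/E$-normal form if no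 $\to_{R/E}$ step starts from it. The step is *innermost* if $u,v$ and a position $p$ can be chosen with $s\to_E^*u\to_{R,p}v\to_E^*t$ such that every proper subterm of $u|_p$ is an $R/E$-normal form. $R/E$ is *terminating* (respectively *innermost terminating*) if no term over $\Sigma$ starts an infinite sequence of $\to_{R/E}$ steps (respectively innermost steps). **Theorem.** Termination and innermost termination are both decidable for right-shallow right-linear TRS modulo permutative theories. That is, there is an algorithm which, given a finite signature $\Sigma$, a right-shallow right-linear TRS $R$ over $\Sigma$ (with no restriction on the left-hand sides beyond those in the definition of a rewrite rule), and a permutative theory $E$ over $\Sigma$, decides whether $R/E$ is terminating; and there is an algorithm which, given the same data, decides whether $R/E$ is innermost terminating. -/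

import Mathlib

namespace RewritingModulo

/-- First-order terms with variables from a countably infinite set. A function symbol is a pair
`(n, f)` of its arity `n` and its name `f`; there are infinitely many symbols of each arity, and a
signature is a finite set of them. The argument list always respects the arity. -/
inductive Term : Type
  | var (x : ℕ) : Term
  | app {n : ℕ} (f : ℕ) (ts : Fin n → Term) : Term

namespace Term

/-! ### Gödel numbering of terms -/

/-- The usual bijective Gödel numbering of terms. -/
def code : Term → ℕ
  | var x => 2 * x
  | app f ts => 2 * Nat.pair f (Encodable.encode (List.ofFn fun i => code (ts i))) + 1

theorem code_injective : Function.Injective code := by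
  intro s
  induction s with
  | var x =>
    intro t h
    cases t with
    | var y => simp only [code] at h; congr 1; omega
    | app g us => simp only [code] at h; omega
  | @app n f ts ih =>
    intro t h
    cases t with
    | var y => simp only [code] at h; omega
    | @app m g us =>
      simp only [code] at h
      have h1 : Nat.pair f (Encodable.encode (List.ofFn fun i => code (ts i)))
          = Nat.pair g (Encodable.encode (List.ofFn fun i => code (us i))) := by omega
      obtain ⟨hf, hl⟩ := Nat.pair_eq_pair.1 h1
      have hl := Encodable.encode_injective hl
      have hn : n = m := by simpa using congrArg List.length hl
      subst hn
      have hfun := List.ofFn_injective hl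
      have : ts = us := funext fun i => ih i (congrFun hfun i)
      rw [hf, this]

theorem lt_succ_encode_of_mem : ∀ (l : List ℕ) (a : ℕ), a ∈ l → a < Encodable.encode l
  | [], a, h => by simp at h
  | b :: l, a, h => by
    rw [Encodable.encode_list_cons]
    rcases List.mem_cons.1 h with rfl | h
    · exact Nat.lt_succ_of_le (Nat.left_le_pair _ _)
    · exact Nat.lt_succ_of_le
        (le_trans (lt_succ_encode_of_mem l a h).le (Nat.right_le_pair _ _))

theorem code_surjective : Function.Surjective code := by
  intro n
  induction n using Nat.strong_induction_on with
  | _ n ih =>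
    rcases Nat.even_or_odd' n with ⟨k, rfl | rfl⟩
    · exact ⟨var k, rfl⟩
    · have key : ∀ a ∈ Denumerable.ofNat (List ℕ) k.unpair.2, ∃ t : Term, code t = a := by
        intro a ha
        apply ih
        have h1 := lt_succ_encode_of_mem _ a ha
        rw [Denumerable.encode_ofNat] at h1
        have h2 := Nat.unpair_right_le k
        omega
      choose g hg using key
      refine ⟨app k.unpair.1
        (fun i : Fin (Denumerable.ofNat (List ℕ) k.unpair.2).length =>
          g ((Denumerable.ofNat (List ℕ) k.unpair.2).get i) (List.get_mem _ i)), ?_⟩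
      simp only [code, hg, List.ofFn_get, Denumerable.encode_ofNat, Nat.pair_unpair]

/-- Terms are in bijection with `ℕ` through `code`. This also yields the `Primcodable` structure
with respect to which computability of functions on terms is understood. -/
noncomputable instance : Denumerable Term :=
  Denumerable.mk' (Equiv.ofBijective code ⟨code_injective, code_surjective⟩)

theorem encode_eq_code (t : Term) : Encodable.encode t = code t := rfl

/-! ### Basic notions on terms -/

/-- The set of variables occurring in a term. -/
def vars : Term → Set ℕ
  | var x => {x}
  | app _ ts => ⋃ i, vars (ts i)

/-- The height of a term: `0` for variables and constants, and one more than the maximal height of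
the arguments otherwise. -/
def height : Term → ℕ
  | var _ => 0
  | app _ ts => Finset.univ.sup fun i => height (ts i) + 1

/-- Application of a substitution. -/
def subst (σ : ℕ → Term) : Term → Term
  | var x => σ x
  | app f ts => app f fun i => subst σ (ts i)

/-- `t.subtermAt p` is the subterm of `t` at position `p`, if `p` is a position of `t`.
Arguments are counted from `0`. -/
def subtermAt : Term → List ℕ → Option Term
  | t, [] => some t
  | var _, _ :: _ => none
  | @app n _ ts, i :: p => if h : i < n then subtermAt (ts ⟨i, h⟩) p else none

/-- `t.replaceAt p s` is the term `t` with its subterm at position `p` replaced by `s`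
(only used when `p` is a position of `t`). -/
def replaceAt : Term → List ℕ → Term → Term
  | _, [], s => s
  | var x, _ :: _, _ => var x
  | app f ts, i :: p, s => app f fun j => if (j : ℕ) = i then replaceAt (ts j) p s else ts j

/-- All function symbols of the term belong to the signature `S`, a finite list of
pairs (arity, name). -/
def Over (S : List (ℕ × ℕ)) : Term → Prop
  | var _ => True
  | @app n f ts => (n, f) ∈ S ∧ ∀ i, Over S (ts i)

/-- All variable positions are at depth `0` or `1`. -/
def Shallow (t : Term) : Prop :=
  ∀ p x, t.subtermAt p = some (var x) → p.length ≤ 1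

/-- The height is at most `1`. -/
def Flat (t : Term) : Prop := t.height ≤ 1

/-- Every variable occurs at most once. -/
def Linear (t : Term) : Prop :=
  ∀ p q x, t.subtermAt p = some (var x) → t.subtermAt q = some (var x) → p = q

end Term

/-- A pair of terms, left-hand side and right-hand side. -/
abbrev Rule : Type := Term × Term

/-- A rewrite rule over the signature `S`: the left-hand side is not a variable, and all variables
of the right-hand side occur in the left-hand side. -/
def IsRewriteRule (S : List (ℕ × ℕ)) (ρ : Rule) : Prop :=
  ρ.1.Over S ∧ ρ.2.Over S ∧ (∀ x, ρ.1 ≠ Term.var x) ∧ ρ.2.vars ⊆ ρ.1.vars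

/-- A (finite) term rewrite system over `S`. -/
def IsTRS (S : List (ℕ × ℕ)) (R : List Rule) : Prop := ∀ ρ ∈ R, IsRewriteRule S ρ

def RightShallow (R : List Rule) : Prop := ∀ ρ ∈ R, ρ.2.Shallow

def RightLinear (R : List Rule) : Prop := ∀ ρ ∈ R, ρ.2.Linear

/-- A permutative rule: a linear flat rewrite rule whose two sides have the same height and the
same variables. -/
def IsPermutativeRule (S : List (ℕ × ℕ)) (ρ : Rule) : Prop :=
  IsRewriteRule S ρ ∧ ρ.1.Linear ∧ ρ.2.Linear ∧ ρ.1.Flat ∧ ρ.2.Flat ∧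
    ρ.1.height = ρ.2.height ∧ ρ.1.vars = ρ.2.vars

/-- A permutative theory over `S`: a finite set of permutative rules closed under exchanging
the two sides. -/
def IsPermutativeTheory (S : List (ℕ × ℕ)) (E : List Rule) : Prop :=
  (∀ ρ ∈ E, IsPermutativeRule S ρ) ∧ ∀ ρ ∈ E, (ρ.2, ρ.1) ∈ E

/-- One rewrite step at position `p`. -/
def StepAt (R : List Rule) (p : List ℕ) (s t : Term) : Prop :=
  ∃ ρ ∈ R, ∃ σ : ℕ → Term,
    s.subtermAt p = some (ρ.1.subst σ) ∧ t = s.replaceAt p (ρ.2.subst σ)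

/-- One rewrite step. -/
def Step (R : List Rule) (s t : Term) : Prop := ∃ p, StepAt R p s t

/-- One step of rewriting with `R` modulo `E`. -/
def ModStep (R E : List Rule) (s t : Term) : Prop :=
  ∃ u v, Relation.ReflTransGen (Step E) s u ∧ Step R u v ∧ Relation.ReflTransGen (Step E) v t

/-- Normal forms with respect to `R` modulo `E`. -/
def IsNormalForm (R E : List Rule) (s : Term) : Prop := ¬ ∃ t, ModStep R E s t

/-- One innermost step with `R` modulo `E`: all proper subterms of the contracted subterm are
normal forms with respect to `R` modulo `E`. -/
def InnermostModStep (R E : List Rule) (s t : Term) : Prop :=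
  ∃ u v p, Relation.ReflTransGen (Step E) s u ∧ StepAt R p u v ∧
    Relation.ReflTransGen (Step E) v t ∧
    ∀ q w, q ≠ [] → u.subtermAt (p ++ q) = some w → IsNormalForm R E w

/-- There is no infinite derivation from `s`. -/
def TerminatingFrom (rel : Term → Term → Prop) (s : Term) : Prop :=
  ¬ ∃ d : ℕ → Term, d 0 = s ∧ ∀ n, rel (d n) (d (n + 1))

/-- `R` modulo `E` terminates, on the terms over the signature `S`. -/
def Terminating (S : List (ℕ × ℕ)) (R E : List Rule) : Prop :=
  ∀ s : Term, s.Over S → TerminatingFrom (ModStep R E) s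

/-- `R` modulo `E` is innermost terminating, on the terms over the signature `S`. -/
def InnermostTerminating (S : List (ℕ × ℕ)) (R E : List Rule) : Prop :=
  ∀ s : Term, s.Over S → TerminatingFrom (InnermostModStep R E) s

end RewritingModulo

/-! Termination and nontermination are both recursively enumerable, with certificates checked by
primitive recursive tests; Post's theorem then gives decidability. Ordinary and innermost rewriting
are treated together through a predicate `Q` that the arguments of a redex must satisfy: always true
in the first case, `IsNormalForm` in the second. Derivations are studied through `Reach`, which
mixes `E`-steps, restricted `R`-steps and passage to arguments.

Nontermination is equivalent to the existence of a loop (`Loops`). A loop contradicts strong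
normalization because, on `E`-classes of strongly normalizing terms, steps and passage to proper
subterms together form a well-founded relation (`wellFounded_below`); here it matters that `E`-steps
preserve the height. Conversely, by right-shallowness every argument of a contractum is a subterm of
an argument of the redex or one of the finitely many variable-free subterms of right-hand sides
(pieces). Without loops this makes the set of terms reachable from any term finite (`finite_reach`),
and the number of terms reachable with at least one `R`-step drops at each `R`-step
(`sn_of_not_loops`). A loop is a finite object; in the innermost case it is accompanied by a finite
`E`-closed list of `R`-irreducible terms, which proves that the arguments of its redexes are normal.

For termination, infinitely many starting terms are reduced to finitely many. Let `N` be a set of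
strongly normalizing terms that contains a variable and all pieces and is closed under steps and
arguments. If every function symbol applied to elements of `N` gives a strongly normalizing term,
then all terms are strongly normalizing (`Base.sn_of_over`). By induction the arguments of a term
are strongly normalizing; call them old and follow a derivation. By right-linearity, a root step
passes an old argument on whole, to at most one place, or else drops it or replaces it by proper
subterms; all further arguments lie in `N`. So the multiset of `E`-classes of old arguments never
grows. While it stays constant, the term whose old arguments are replaced by a variable makes the
same `R`-steps, and that term has arguments in `N`, hence is strongly normalizing. If there are no
loops, a finite `N` exists, and numerical ranks certify strong normalization of the finitely many
terms built on it. -/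

namespace RewritingModulo

/-! ### Rewriting as closure under contexts; consequences of the shape of the rules. -/

open Relation

namespace Term

/-! ### Arguments, subterms and variables -/

/-- `Child s t` holds when `t` is an argument of `s`. -/
inductive Child : Term → Term → Prop
  | mk {n : ℕ} (f : ℕ) (ts : Fin n → Term) (i : Fin n) : Child (app f ts) (ts i)

theorem not_child_var {x : ℕ} {t : Term} : ¬ Child (var x) t := by
  rintro ⟨⟩

theorem child_app {n f : ℕ} {ts : Fin n → Term} {t : Term} :
    Child (app f ts) t ↔ ∃ i, ts i = t := by
  constructor
  · rintro ⟨⟩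
    exact ⟨_, rfl⟩
  · rintro ⟨i, rfl⟩
    exact .mk f ts i

theorem height_lt_of_child {s t : Term} (h : Child s t) : t.height < s.height := by
  cases h with
  | mk f ts i =>
    exact Finset.le_sup (f := fun i => height (ts i) + 1) (Finset.mem_univ i)

theorem height_le_of_sub {s t : Term} (h : ReflTransGen Child s t) : t.height ≤ s.height := by
  induction h with
  | refl => exact le_rfl
  | tail _ h ih => exact (height_lt_of_child h).le.trans ih

theorem mem_vars_app {n f x : ℕ} {ts : Fin n → Term} :
    x ∈ (app f ts).vars ↔ ∃ i, x ∈ (ts i).vars := by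
  simp [vars]

theorem mem_vars_var {x y : ℕ} : x ∈ (var y).vars ↔ x = y := Iff.rfl

theorem vars_eq_empty_of_child {s t : Term} (h : Child s t) (hs : s.vars = ∅) : t.vars = ∅ := by
  cases h with
  | mk f ts i =>
    refine Set.eq_empty_of_forall_notMem fun x hx => ?_
    have : x ∈ (app f ts).vars := mem_vars_app.2 ⟨i, hx⟩
    simp [hs] at this

theorem subst_congr {σ τ : ℕ → Term} : ∀ {t : Term}, (∀ x ∈ t.vars, σ x = τ x) →
    t.subst σ = t.subst τ
  | var x, h => h x rfl
  | app f ts, h => by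
    simp only [subst]
    congr 1
    exact funext fun i => subst_congr fun x hx => h x (mem_vars_app.2 ⟨i, hx⟩)

theorem subst_var_self (t : Term) : t.subst var = t := by
  induction t with
  | var x => rfl
  | app f ts ih => simp [subst, ih]

theorem subst_of_vars_eq_empty {t : Term} (h : t.vars = ∅) (σ : ℕ → Term) : t.subst σ = t := by
  rw [subst_congr (τ := var) (by simp [h]), subst_var_self]

theorem sub_subst {σ : ℕ → Term} {x : ℕ} : ∀ {t : Term}, x ∈ t.vars →
    ReflTransGen Child (t.subst σ) (σ x)
  | var y, h => by
    rw [mem_vars_var] at h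
    subst h
    exact .refl
  | app f ts, h => by
    obtain ⟨i, hi⟩ := mem_vars_app.1 h
    exact .head (.mk f (fun i => subst σ (ts i)) i) (sub_subst hi)

theorem exists_subtermAt_of_mem_vars {x : ℕ} : ∀ {t : Term}, x ∈ t.vars →
    ∃ p, t.subtermAt p = some (var x)
  | var y, h => ⟨[], by rw [mem_vars_var] at h; simp [subtermAt, h]⟩
  | app f ts, h => by
    obtain ⟨i, hi⟩ := mem_vars_app.1 h
    obtain ⟨p, hp⟩ := exists_subtermAt_of_mem_vars hi
    exact ⟨i :: p, by simpa [subtermAt] using hp⟩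

theorem Shallow.arg {n g : ℕ} {rs : Fin n → Term} (h : (app g rs).Shallow) (j : Fin n) :
    (∃ x, rs j = var x) ∨ (rs j).vars = ∅ := by
  cases hr : rs j with
  | var x => exact .inl ⟨x, rfl⟩
  | app k us =>
    refine .inr (Set.eq_empty_of_forall_notMem fun x hx => ?_)
    obtain ⟨i, hi⟩ := mem_vars_app.1 hx
    obtain ⟨p, hp⟩ := exists_subtermAt_of_mem_vars hi
    have := h (j :: i :: p) x (by simpa [subtermAt, hr] using hp)
    simp at this

theorem Linear.arg_injective {n g x : ℕ} {rs : Fin n → Term} (h : (app g rs).Linear)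
    {i j : Fin n} (hi : rs i = var x) (hj : rs j = var x) : i = j := by
  have := h [i.1] [j.1] x (by simp [subtermAt, hi]) (by simp [subtermAt, hj])
  exact Fin.ext (by simpa using this)

theorem over_app {S : List (ℕ × ℕ)} {n f : ℕ} {ts : Fin n → Term} :
    (app f ts).Over S ↔ (n, f) ∈ S ∧ ∀ i, (ts i).Over S := Iff.rfl

theorem Over.child {S : List (ℕ × ℕ)} {s t : Term} (hs : s.Over S) (h : Child s t) :
    t.Over S := by
  cases h with
  | mk f ts i => exact hs.2 i

theorem Over.sub {S : List (ℕ × ℕ)} {s t : Term} (hs : s.Over S) (h : ReflTransGen Child s t) :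
    t.Over S := by
  induction h with
  | refl => exact hs
  | tail _ h ih => exact ih.child h

theorem Over.subst {S : List (ℕ × ℕ)} {σ : ℕ → Term} : ∀ {t : Term}, t.Over S →
    (∀ x ∈ t.vars, (σ x).Over S) → (t.subst σ).Over S
  | var x, _, h => h x rfl
  | app _ _, ht, h =>
    ⟨ht.1, fun i => Over.subst (ht.2 i) fun x hx => h x (mem_vars_app.2 ⟨i, hx⟩)⟩

theorem subtermAt_append : ∀ (s : Term) (p q : List ℕ),
    s.subtermAt (p ++ q) = (s.subtermAt p).bind fun u => u.subtermAt q
  | s, [], q => by simp [subtermAt]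
  | var x, i :: p, q => by simp [subtermAt]
  | @app n f ts, i :: p, q => by
    by_cases h : i < n
    · simpa [subtermAt, h] using subtermAt_append (ts ⟨i, h⟩) p q
    · simp [subtermAt, h]

theorem sub_of_subtermAt : ∀ {s w : Term} (p : List ℕ), s.subtermAt p = some w →
    ReflTransGen Child s w
  | s, w, [], h => by
    simp only [subtermAt, Option.some.injEq] at h
    exact h ▸ .refl
  | var x, w, i :: p, h => by simp [subtermAt] at h
  | @app n f ts, w, i :: p, h => by
    by_cases hi : i < n
    · simp only [subtermAt, hi, dif_pos] at h
      exact .head (.mk f ts ⟨i, hi⟩) (sub_of_subtermAt p h)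
    · simp [subtermAt, hi] at h

end Term

open Term

/-! ### Steps -/

/-- The closure of a relation on terms under contexts. -/
inductive CtxStep (T : Term → Term → Prop) : Term → Term → Prop
  | root {s t : Term} : T s t → CtxStep T s t
  | arg {n : ℕ} (f : ℕ) (ts : Fin n → Term) (i : Fin n) {t : Term} :
      CtxStep T (ts i) t → CtxStep T (app f ts) (app f (Function.update ts i t))

/-- A step at the root, allowed only if all arguments of the redex satisfy `Q`. -/
def RootStep (Q : Term → Prop) (R : List Rule) (s t : Term) : Prop :=
  ∃ ρ ∈ R, ∃ σ : ℕ → Term, s = ρ.1.subst σ ∧ t = ρ.2.subst σ ∧ ∀ w, Child s w → Q w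

/-- A step anywhere, allowed only if all arguments of the redex satisfy `Q`. -/
def RStep (Q : Term → Prop) (R : List Rule) : Term → Term → Prop := CtxStep (RootStep Q R)

/-- An unrestricted step. -/
def EStep (E : List Rule) : Term → Term → Prop := RStep (fun _ => True) E

/-- A restricted step modulo `E`. -/
def RModStep (Q : Term → Prop) (R E : List Rule) (s t : Term) : Prop :=
  ∃ u v, ReflTransGen (EStep E) s u ∧ RStep Q R u v ∧ ReflTransGen (EStep E) v t

/-- Strong normalization with respect to restricted steps modulo `E`. -/
def SN (Q : Term → Prop) (R E : List Rule) : Term → Prop := Acc (flip (RModStep Q R E))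

/-- Either a step or a passage to an argument. -/
def SubStep (Q : Term → Prop) (R E : List Rule) (s t : Term) : Prop :=
  EStep E s t ∨ RStep Q R s t ∨ Child s t

theorem CtxStep.mono {T T' : Term → Term → Prop} {s t : Term} (h : CtxStep T s t)
    (hT : ∀ u v, ReflTransGen Child s u → T u v → T' u v) : CtxStep T' s t := by
  induction h with
  | root h => exact .root (hT _ _ .refl h)
  | arg f ts i h ih =>
    exact .arg f ts i (ih fun u v hu => hT u v (.head (.mk f ts i) hu))

theorem RStep.mono {Q Q' : Term → Prop} {R : List Rule} {s t : Term} (h : RStep Q R s t)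
    (hQ : ∀ w, ReflTransGen Child s w → Q w → Q' w) : RStep Q' R s t :=
  CtxStep.mono h fun _ _ hu ⟨ρ, hρ, σ, h₁, h₂, h₃⟩ =>
    ⟨ρ, hρ, σ, h₁, h₂, fun w hw => hQ w (hu.tail hw) (h₃ w hw)⟩

theorem CtxStep.lift_child {T : Term → Term → Prop} {t u u' : Term} (hu : Child t u)
    (h : CtxStep T u u') : ∃ t', CtxStep T t t' ∧ Child t' u' := by
  cases hu with
  | mk f ts i =>
    refine ⟨_, .arg f ts i h, ?_⟩
    have := Child.mk f (Function.update ts i u') i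
    rwa [Function.update_self] at this

theorem CtxStep.lift {T : Term → Term → Prop} {t u u' : Term} (hu : ReflTransGen Child t u)
    (h : CtxStep T u u') : ∃ t', CtxStep T t t' ∧ ReflTransGen Child t' u' := by
  induction hu generalizing u' with
  | refl => exact ⟨u', h, .refl⟩
  | tail _ hc ih =>
    obtain ⟨v, hv, hc'⟩ := h.lift_child hc
    obtain ⟨t', ht', hs⟩ := ih hv
    exact ⟨t', ht', hs.tail hc'⟩

theorem CtxStep.lift_star {T : Term → Term → Prop} {t u u' : Term} (hu : ReflTransGen Child t u)
    (h : ReflTransGen (CtxStep T) u u') :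
    ∃ t', ReflTransGen (CtxStep T) t t' ∧ ReflTransGen Child t' u' := by
  induction h with
  | refl => exact ⟨t, .refl, hu⟩
  | tail _ h ih =>
    obtain ⟨t₁, h₁, hs⟩ := ih
    obtain ⟨t₂, h₂, hs₂⟩ := h.lift hs
    exact ⟨t₂, h₁.tail h₂, hs₂⟩

theorem RModStep.lift {Q : Term → Prop} {R E : List Rule} {t u u' : Term}
    (hu : ReflTransGen Child t u) (h : RModStep Q R E u u') :
    ∃ t', RModStep Q R E t t' ∧ ReflTransGen Child t' u' := by
  obtain ⟨v, w, h₁, h₂, h₃⟩ := h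
  obtain ⟨t₁, k₁, s₁⟩ := CtxStep.lift_star hu h₁
  obtain ⟨t₂, k₂, s₂⟩ := CtxStep.lift s₁ h₂
  obtain ⟨t₃, k₃, s₃⟩ := CtxStep.lift_star s₂ h₃
  exact ⟨t₃, ⟨t₁, t₂, k₁, k₂, k₃⟩, s₃⟩

section SN

variable {Q : Term → Prop} {R E : List Rule} {s t : Term}

theorem SN.eStep (hs : SN Q R E s) (h : EStep E s t) : SN Q R E t :=
  Acc.intro _ fun _ ⟨u, v, h₁, h₂, h₃⟩ => hs.inv ⟨u, v, .head h h₁, h₂, h₃⟩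

theorem SN.eStar (hs : SN Q R E s) (h : ReflTransGen (EStep E) s t) : SN Q R E t := by
  induction h with
  | refl => exact hs
  | tail _ h ih => exact ih.eStep h

theorem SN.rStep (hs : SN Q R E s) (h : RStep Q R s t) : SN Q R E t :=
  hs.inv ⟨s, t, .refl, h, .refl⟩

/-- The restriction looks only at the arguments of the redex, so a step of a subterm is also a step
of the surrounding term. Hence the induction runs on the surrounding term. -/
theorem SN.sub (hs : SN Q R E s) : ∀ {u}, ReflTransGen Child s u → SN Q R E u := by
  induction hs with
  | intro s _ ih =>
    intro u hu
    refine Acc.intro _ fun u' hu' => ?_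
    obtain ⟨t', ht', hs'⟩ := RModStep.lift hu hu'
    exact ih t' ht' hs'

end SN

/-! ### Comparison with steps at positions -/

theorem replaceAt_cons {n : ℕ} (f : ℕ) (ts : Fin n → Term) (i : Fin n) (p : List ℕ) (s : Term) :
    (app f ts).replaceAt (i :: p) s = app f (Function.update ts i ((ts i).replaceAt p s)) := by
  simp only [replaceAt]
  congr 1
  funext j
  by_cases h : j = i
  · subst h; simp
  · have : (j : ℕ) ≠ i := fun h' => h (Fin.ext h')
    simp [h, this]

theorem rStep_iff {Q : Term → Prop} {R : List Rule} {s t : Term} :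
    RStep Q R s t ↔ ∃ p, StepAt R p s t ∧
      ∀ u w, s.subtermAt p = some u → Child u w → Q w := by
  constructor
  · intro h
    induction h with
    | root h =>
      obtain ⟨ρ, hρ, σ, rfl, rfl, hQ⟩ := h
      refine ⟨[], ⟨ρ, hρ, σ, by simp [subtermAt], by simp [replaceAt]⟩, fun u w hu hw => ?_⟩
      simp only [subtermAt, Option.some.injEq] at hu
      exact hQ w (hu ▸ hw)
    | arg f ts i h ih =>
      obtain ⟨p, ⟨ρ, hρ, σ, h₁, h₂⟩, hQ⟩ := ih
      refine ⟨i :: p, ⟨ρ, hρ, σ, by simpa [subtermAt] using h₁, ?_⟩, ?_⟩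
      · rw [replaceAt_cons, h₂]
      · intro u w hu
        exact hQ u w (by simpa [subtermAt] using hu)
  · rintro ⟨p, ⟨ρ, hρ, σ, h₁, h₂⟩, hQ⟩
    induction p generalizing s t with
    | nil =>
      simp only [subtermAt, Option.some.injEq] at h₁
      subst h₁
      exact .root ⟨ρ, hρ, σ, rfl, by rw [h₂]; simp [replaceAt], fun w => hQ _ w (by simp [subtermAt])⟩
    | cons i p ih =>
      cases s with
      | var x => simp [subtermAt] at h₁
      | @app n f ts =>
        by_cases hi : i < n
        · have hsub : ∀ q, (app f ts).subtermAt (i :: q) = (ts ⟨i, hi⟩).subtermAt q := by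
            intro q; simp [subtermAt, hi]
          rw [hsub] at h₁ hQ
          rw [h₂, show i = ((⟨i, hi⟩ : Fin n) : ℕ) from rfl, replaceAt_cons]
          exact .arg f ts _ (ih hQ h₁ rfl)
        · simp [subtermAt, hi] at h₁

theorem step_iff_eStep {R : List Rule} {s t : Term} : Step R s t ↔ EStep R s t := by
  simp [EStep, rStep_iff, Step]

theorem modStep_iff {R E : List Rule} {s t : Term} :
    ModStep R E s t ↔ RModStep (fun _ => True) R E s t := by
  have h : ∀ R, Step R = EStep R := fun R => by
    ext s t
    exact step_iff_eStep
  simp only [ModStep, RModStep, h]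
  rfl

theorem IsNormalForm.sub {R E : List Rule} {s t : Term} (hs : IsNormalForm R E s)
    (h : ReflTransGen Child s t) : IsNormalForm R E t := by
  rintro ⟨t', ht'⟩
  obtain ⟨s', hs', -⟩ := RModStep.lift h (modStep_iff.1 ht')
  exact hs ⟨s', modStep_iff.2 hs'⟩

/-- Normal forms are closed under subterms, so it suffices to restrict the arguments of the redex
instead of all its proper subterms. -/
theorem innermostModStep_iff {R E : List Rule} {s t : Term} :
    InnermostModStep R E s t ↔ RModStep (IsNormalForm R E) R E s t := by
  have h : Step E = EStep E := by
    ext s t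
    exact step_iff_eStep
  simp only [InnermostModStep, RModStep, h, rStep_iff]
  constructor
  · rintro ⟨u, v, p, h₁, h₂, h₃, h₄⟩
    refine ⟨u, v, h₁, ⟨p, h₂, ?_⟩, h₃⟩
    rintro _ _ hu ⟨f, ts, i⟩
    refine h₄ [i.1] _ (by simp) ?_
    rw [subtermAt_append, hu]
    simp [subtermAt]
  · rintro ⟨u, v, h₁, ⟨p, h₂, h₄⟩, h₃⟩
    refine ⟨u, v, p, h₁, h₂, h₃, fun q w hq hw => ?_⟩
    rw [subtermAt_append] at hw
    cases hu : u.subtermAt p with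
    | none => simp [hu] at hw
    | some u' =>
      simp only [hu, Option.bind_some] at hw
      cases q with
      | nil => exact absurd rfl hq
      | cons i q =>
        cases u' with
        | var x => simp [subtermAt] at hw
        | @app n f ts =>
          by_cases hi : i < n
          · simp only [subtermAt, hi, dif_pos] at hw
            exact (h₄ _ _ hu (.mk f ts ⟨i, hi⟩)).sub (sub_of_subtermAt q hw)
          · simp [subtermAt, hi] at hw

theorem terminatingFrom_iff_acc {r : Term → Term → Prop} {s : Term} :
    TerminatingFrom r s ↔ Acc (flip r) s := by
  rw [TerminatingFrom, not_iff_comm, not_acc_iff_exists_descending_chain]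
  exact Iff.rfl

/-- The restriction imposed on arguments of redexes: none, or to be a normal form. -/
def Restr (b : Bool) (R E : List Rule) (w : Term) : Prop := b = true → IsNormalForm R E w

theorem restr_false {R E : List Rule} : Restr false R E = fun _ => True := by
  funext w
  simp [Restr]

theorem restr_true {R E : List Rule} : Restr true R E = IsNormalForm R E := by
  funext w
  simp [Restr]

theorem terminating_iff {S : List (ℕ × ℕ)} {R E : List Rule} :
    Terminating S R E ↔ ∀ s : Term, s.Over S → SN (Restr false R E) R E s := by
  have h : ModStep R E = RModStep (Restr false R E) R E := by
    ext s t
    rw [modStep_iff, restr_false]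
  simp only [Terminating, terminatingFrom_iff_acc, SN, h]

theorem innermostTerminating_iff {S : List (ℕ × ℕ)} {R E : List Rule} :
    InnermostTerminating S R E ↔ ∀ s : Term, s.Over S → SN (Restr true R E) R E s := by
  have h : InnermostModStep R E = RModStep (Restr true R E) R E := by
    ext s t
    rw [innermostModStep_iff, restr_true]
  simp only [InnermostTerminating, terminatingFrom_iff_acc, SN, h]

/-! ### Rewrite systems modulo permutative theories -/

/-- A rewrite rule whose right-hand side is such that each argument is a variable or
variable-free, and such that no two arguments are the same variable. -/
structure GoodRule (S : List (ℕ × ℕ)) (ρ : Rule) : Prop where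
  isRewriteRule : IsRewriteRule S ρ
  shallow : ∀ (n g : ℕ) (rs : Fin n → Term), ρ.2 = app g rs →
    ∀ j, (∃ x, rs j = var x) ∨ (rs j).vars = ∅
  linear : ∀ (n g : ℕ) (rs : Fin n → Term), ρ.2 = app g rs →
    ∀ i j x, rs i = var x → rs j = var x → i = j

/-- A right-shallow right-linear rewrite system together with a permutative theory. -/
structure System (S : List (ℕ × ℕ)) (R E : List Rule) : Prop where
  good : ∀ ρ ∈ R ++ E, GoodRule S ρ
  flat : ∀ ρ ∈ E, ρ.1.Flat
  height : ∀ ρ ∈ E, ρ.1.height = ρ.2.height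
  symm : ∀ ρ ∈ E, (ρ.2, ρ.1) ∈ E

theorem Term.Flat.shallow {t : Term} (h : t.Flat) : t.Shallow := by
  intro p x hp
  have key : ∀ (p : List ℕ) (t u : Term), t.subtermAt p = some u → p.length ≤ t.height := by
    intro p
    induction p with
    | nil => simp
    | cons i p ih =>
      intro t u h
      cases t with
      | var x => simp [subtermAt] at h
      | @app n f ts =>
        by_cases hi : i < n
        · simp only [subtermAt, hi, dif_pos] at h
          have := ih _ _ h
          have := height_lt_of_child (.mk f ts ⟨i, hi⟩)
          simp only [List.length_cons]
          omega
        · simp [subtermAt, hi] at h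
  exact (key p t _ hp).trans h

theorem GoodRule.of_shallow {S : List (ℕ × ℕ)} {ρ : Rule} (h : IsRewriteRule S ρ)
    (hs : ρ.2.Shallow) (hl : ρ.2.Linear) : GoodRule S ρ := by
  refine ⟨h, fun n g rs hr j => ?_, fun n g rs hr i j x hi hj => ?_⟩
  · rw [hr] at hs
    exact hs.arg j
  · rw [hr] at hl
    exact hl.arg_injective hi hj

/-- Flat terms are shallow, so the rules of `E` satisfy the same condition as those of `R`, and root
steps of both kinds can be analysed uniformly. -/
theorem System.of_permutative {S : List (ℕ × ℕ)} {R E : List Rule} (hR : IsTRS S R)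
    (hs : RightShallow R) (hl : RightLinear R) (hE : IsPermutativeTheory S E) :
    System S R E where
  good ρ hρ := by
    rcases List.mem_append.1 hρ with h | h
    · exact .of_shallow (hR ρ h) (hs ρ h) (hl ρ h)
    · obtain ⟨h₁, -, h₂, -, h₃, -⟩ := hE.1 ρ h
      exact .of_shallow h₁ h₃.shallow h₂
  flat ρ h := (hE.1 ρ h).2.2.2.1
  height ρ h := (hE.1 ρ h).2.2.2.2.2.1
  symm := hE.2

theorem GoodRule.lhs {S : List (ℕ × ℕ)} {ρ : Rule} (h : GoodRule S ρ) :
    ∃ n f, ∃ ls : Fin n → Term, ρ.1 = app f ls := by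
  cases hl : ρ.1 with
  | var x => exact absurd hl (h.isRewriteRule.2.2.1 x)
  | app f ls => exact ⟨_, f, ls, rfl⟩

theorem GoodRule.child_sub {S : List (ℕ × ℕ)} {ρ : Rule} (h : GoodRule S ρ) {σ : ℕ → Term}
    {x : ℕ} (hx : x ∈ ρ.2.vars) :
    ∃ w, Child (ρ.1.subst σ) w ∧ ReflTransGen Child w (σ x) := by
  have hx' := h.isRewriteRule.2.2.2 hx
  obtain ⟨n, f, ls, hl⟩ := h.lhs
  rw [hl] at hx' ⊢
  obtain ⟨i, hi⟩ := mem_vars_app.1 hx'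
  exact ⟨_, .mk f (fun i => (ls i).subst σ) i, sub_subst hi⟩

section Good

variable {S : List (ℕ × ℕ)} {Q : Term → Prop} {R E : List Rule}

theorem RStep.over (hR : ∀ ρ ∈ R, GoodRule S ρ) {s t : Term} (h : RStep Q R s t)
    (hs : s.Over S) : t.Over S := by
  induction h with
  | root h =>
    obtain ⟨ρ, hρ, σ, rfl, rfl, -⟩ := h
    refine (hR ρ hρ).isRewriteRule.2.1.subst fun x hx => ?_
    obtain ⟨w, h₁, h₂⟩ := (hR ρ hρ).child_sub (σ := σ) hx
    exact (hs.child h₁).sub h₂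
  | arg f ts i h ih =>
    refine ⟨hs.1, fun j => ?_⟩
    by_cases hj : j = i
    · subst hj
      simpa using ih (hs.2 j)
    · simpa [hj] using hs.2 j

theorem not_rStep_var (hR : ∀ ρ ∈ R, GoodRule S ρ) {x : ℕ} {t : Term} :
    ¬ RStep Q R (var x) t := by
  intro h
  cases h with
  | root h =>
    obtain ⟨ρ, hρ, σ, h, -⟩ := h
    obtain ⟨n, f, ls, hl⟩ := (hR ρ hρ).lhs
    rw [hl] at h
    simp [subst] at h

theorem System.goodR (h : System S R E) : ∀ ρ ∈ R, GoodRule S ρ :=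
  fun ρ hρ => h.good ρ (List.mem_append_left _ hρ)

theorem System.goodE (h : System S R E) : ∀ ρ ∈ E, GoodRule S ρ :=
  fun ρ hρ => h.good ρ (List.mem_append_right _ hρ)

theorem System.nil (h : System S R E) : System S [] E :=
  ⟨h.goodE, h.flat, h.height, h.symm⟩

theorem SubStep.over (h : System S R E) {s t : Term} (hst : SubStep Q R E s t)
    (hs : s.Over S) : t.Over S := by
  rcases hst with h' | h' | h'
  · exact RStep.over h.goodE h' hs
  · exact RStep.over h.goodR h' hs
  · exact hs.child h'

theorem SubStep.star_over (h : System S R E) {s t : Term}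
    (hst : ReflTransGen (SubStep Q R E) s t) (hs : s.Over S) : t.Over S := by
  induction hst with
  | refl => exact hs
  | tail _ h' ih => exact h'.over h ih

/-- The arguments of a flat term are variables and constants. The value of a variable argument
reappears strictly below the root of the other side. A constant argument only needs the other side
to have some argument, which the equality of heights forces. -/
theorem height_subst_le_of_flat {n m f g : ℕ} {ls : Fin n → Term} {rs : Fin m → Term}
    (hl : (app f ls).Flat) (hh : (app f ls).height = (app g rs).height)
    (hv : (app f ls).vars ⊆ (app g rs).vars) (σ : ℕ → Term) :
    ((app f ls).subst σ).height ≤ ((app g rs).subst σ).height := by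
  simp only [subst]
  rw [height]
  refine Finset.sup_le fun i _ => ?_
  have hi : (ls i).height = 0 := by
    have := height_lt_of_child (.mk f ls i)
    have : (app f ls).height ≤ 1 := hl
    omega
  have hm : 0 < (app g rs).height := by
    rw [← hh]
    exact (Nat.zero_le _).trans_lt (height_lt_of_child (.mk f ls i))
  cases hli : ls i with
  | var x =>
    have hx : x ∈ (app g rs).vars := hv (mem_vars_app.2 ⟨i, by rw [hli]; rfl⟩)
    obtain ⟨j, hj⟩ := mem_vars_app.1 hx
    have h₁ := height_le_of_sub (sub_subst (σ := σ) hj)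
    have h₂ := height_lt_of_child (.mk g (fun i => subst σ (rs i)) j)
    simp only [subst]
    omega
  | @app k c us =>
    have hk : k = 0 := by
      by_contra hk
      have := height_lt_of_child (.mk c us ⟨0, Nat.pos_of_ne_zero hk⟩)
      rw [hli] at hi
      omega
    have : 0 < m := by
      by_contra hm'
      obtain rfl : m = 0 := by omega
      simp [height] at hm
    have h₂ := height_lt_of_child (.mk g (fun i => subst σ (rs i)) ⟨0, this⟩)
    subst hk
    simp only [subst, height, Finset.univ_eq_empty, Finset.sup_empty]
    simp only [height] at h₂
    exact Nat.succ_le_of_lt ((Nat.zero_le _).trans_lt h₂)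

theorem EStep.height_eq (h : System S R E) {s t : Term} (hst : EStep E s t) :
    s.height = t.height := by
  induction hst with
  | root h' =>
    obtain ⟨ρ, hρ, σ, rfl, rfl, -⟩ := h'
    have hρ' := h.symm ρ hρ
    obtain ⟨n, f, ls, hl⟩ := (h.goodE ρ hρ).lhs
    obtain ⟨m, g, rs, hr⟩ := (h.goodE _ hρ').lhs
    have hr : ρ.2 = app g rs := hr
    have h₁ := (h.goodE ρ hρ).isRewriteRule.2.2.2
    have h₂ : ρ.1.vars ⊆ ρ.2.vars := (h.goodE _ hρ').isRewriteRule.2.2.2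
    have h₃ := h.height ρ hρ
    have h₄ := h.flat ρ hρ
    have h₅ : ρ.2.Flat := h.flat _ hρ'
    rw [hl, hr] at *
    exact le_antisymm (height_subst_le_of_flat h₄ h₃ h₂ σ)
      (height_subst_le_of_flat h₅ h₃.symm h₁ σ)
  | arg f ts i _ ih =>
    simp only [height]
    congr 1
    funext j
    by_cases hj : j = i
    · subst hj
      simp [ih]
    · simp [hj]

theorem EStep.symm (h : System S R E) {s t : Term} (hst : EStep E s t) : EStep E t s := by
  induction hst with
  | root h' =>
    obtain ⟨ρ, hρ, σ, rfl, rfl, -⟩ := h'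
    exact .root ⟨_, h.symm ρ hρ, σ, rfl, rfl, fun _ _ => trivial⟩
  | @arg n f ts i t _ ih =>
    have := CtxStep.arg (T := RootStep (fun _ => True) E) f (Function.update ts i t) i (t := ts i)
      (by rw [Function.update_self]; exact ih)
    rw [Function.update_idem, Function.update_eq_self] at this
    exact this

end Good

end RewritingModulo
-- Without loops: finitely many reachable terms, hence strong normalization.
namespace RewritingModulo

open Relation Term

/-! ### Absence of loops makes the sets of reachable terms finite -/

/-- Reachability by steps and passages to arguments. -/
def Reach (Q : Term → Prop) (R E : List Rule) : Term → Term → Prop :=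
  ReflTransGen (SubStep Q R E)

/-- Some term over `S` reaches, by a nonempty sequence of steps, a term containing it. -/
def Loops (S : List (ℕ × ℕ)) (Q : Term → Prop) (R E : List Rule) : Prop :=
  ∃ u v, u.Over S ∧ RStep Q R u v ∧ Reach Q R E v u

/-- The variable-free subterms of right-hand sides. -/
def Piece (R E : List Rule) (b : Term) : Prop :=
  ∃ ρ ∈ R ++ E, ReflTransGen Child ρ.2 b ∧ b.vars = ∅

/-- The terms with a root symbol from `S` and arguments from `U`. -/
def appSet (S : List (ℕ × ℕ)) (U : Set Term) : Set Term :=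
  {t | ∃ n f, ∃ ts : Fin n → Term, (n, f) ∈ S ∧ (∀ i, ts i ∈ U) ∧ t = app f ts}

theorem finite_setOf_sub (t : Term) : {b | ReflTransGen Child t b}.Finite := by
  induction t with
  | var x =>
    refine (Set.finite_singleton (var x)).subset fun b hb => ?_
    rcases ReflTransGen.cases_head hb with h | ⟨c, h, -⟩
    · exact h.symm
    · exact absurd h not_child_var
  | app f ts ih =>
    refine ((Set.finite_singleton (app f ts)).union (Set.finite_iUnion ih)).subset fun b hb => ?_
    rcases ReflTransGen.cases_head hb with h | ⟨c, h, hc⟩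
    · exact .inl h.symm
    · obtain ⟨i, rfl⟩ := child_app.1 h
      exact .inr (Set.mem_iUnion.2 ⟨i, hc⟩)

theorem finite_setOf_piece (R E : List Rule) : {b | Piece R E b}.Finite := by
  refine ((R ++ E).finite_toSet.biUnion fun ρ _ => finite_setOf_sub ρ.2).subset ?_
  rintro b ⟨ρ, hρ, hb, -⟩
  exact Set.mem_biUnion hρ hb

theorem appSet_finite (S : List (ℕ × ℕ)) {U : Set Term} (hU : U.Finite) :
    (appSet S U).Finite := by
  have : appSet S U ⊆ ⋃ p ∈ {p | p ∈ S},
      (fun ts : Fin p.1 → Term => app p.2 ts) '' Set.pi Set.univ fun _ => U := by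
    rintro t ⟨n, f, ts, h, hts, rfl⟩
    exact Set.mem_biUnion (x := (n, f)) h ⟨ts, fun i _ => hts i, rfl⟩
  exact (S.finite_toSet.biUnion fun p _ => (Set.Finite.pi fun _ => hU).image _).subset this

theorem Piece.child {R E : List Rule} {a b : Term} (ha : Piece R E a) (h : Child a b) :
    Piece R E b := by
  obtain ⟨ρ, hρ, hs, hv⟩ := ha
  exact ⟨ρ, hρ, hs.tail h, vars_eq_empty_of_child h hv⟩

section

variable {S : List (ℕ × ℕ)} {Q : Term → Prop} {R E : List Rule}

theorem Piece.over (h : System S R E) {b : Term} (hb : Piece R E b) : b.Over S := by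
  obtain ⟨ρ, hρ, hs, -⟩ := hb
  exact ((h.good ρ hρ).isRewriteRule.2.1).sub hs

/-- Right-shallowness enters here: a root step creates no arguments other than pieces and subterms
of the old arguments. -/
theorem rootStep_cases (h : System S R E) {Q' : Term → Prop} {R' : List Rule}
    (hR' : R' ⊆ R ++ E) {s t : Term} (hst : RootStep Q' R' s t) :
    (∃ w, Child s w ∧ ReflTransGen Child w t) ∨
      ∃ m g, ∃ us : Fin m → Term, (m, g) ∈ S ∧ t = app g us ∧
        ∀ j, (∃ w, Child s w ∧ ReflTransGen Child w (us j)) ∨ Piece R E (us j) := by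
  obtain ⟨ρ, hρ, σ, rfl, rfl, -⟩ := hst
  have hg := h.good ρ (hR' hρ)
  cases hr : ρ.2 with
  | var x =>
    exact .inl (hg.child_sub (by rw [hr]; rfl))
  | @app m g rs =>
    refine .inr ⟨m, g, _, ?_, rfl, fun j => ?_⟩
    · have := hg.isRewriteRule.2.1
      rw [hr] at this
      exact this.1
    · rcases hg.shallow _ _ _ hr j with ⟨x, hx⟩ | hv
      · left
        rw [hx]
        exact hg.child_sub (by rw [hr]; exact mem_vars_app.2 ⟨j, by rw [hx]; rfl⟩)
      · right
        rw [subst_of_vars_eq_empty hv]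
        exact ⟨ρ, hR' hρ, by rw [hr]; exact .single (.mk g rs j), hv⟩

theorem mem_of_sub {U : Set Term} (hU : ∀ x ∈ U, ∀ y, SubStep Q R E x y → y ∈ U) {s t : Term}
    (hs : s ∈ U) (h : ReflTransGen Child s t) : t ∈ U := by
  induction h with
  | refl => exact hs
  | tail _ h ih => exact hU _ ih _ (.inr (.inr h))

theorem step_mem_appSet (h : System S R E) {U : Set Term}
    (hU : ∀ x ∈ U, ∀ y, SubStep Q R E x y → y ∈ U) {Q' : Term → Prop} {R' : List Rule}
    (hR' : R' ⊆ R ++ E) (hsub : ∀ s t, RStep Q' R' s t → SubStep Q R E s t) {s t : Term}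
    (hs : s ∈ appSet S U) (hst : RStep Q' R' s t)
    (hp : ∀ b, Child t b → Piece R E b → b ∈ U) : t ∈ U ∨ t ∈ appSet S U := by
  obtain ⟨n, f, ts, hf, hts, rfl⟩ := hs
  have hchild : ∀ w t, Child (app f ts) w → ReflTransGen Child w t → t ∈ U := by
    intro w t hw ht
    obtain ⟨i, rfl⟩ := child_app.1 hw
    exact mem_of_sub hU (hts i) ht
  cases hst with
  | root hst =>
    rcases rootStep_cases h hR' hst with ⟨w, h₁, h₂⟩ | ⟨m, g, us, hg, rfl, hus⟩
    · exact .inl (hchild w _ h₁ h₂)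
    · refine .inr ⟨m, g, us, hg, fun j => ?_, rfl⟩
      rcases hus j with ⟨w, h₁, h₂⟩ | hj
      · exact hchild w _ h₁ h₂
      · exact hp _ (.mk g us j) hj
  | arg f ts i hst =>
    refine .inr ⟨n, f, _, hf, fun j => ?_, rfl⟩
    by_cases hj : j = i
    · subst hj
      simpa using hU _ (hts j) _ (hsub _ _ hst)
    · simpa [hj] using hts j

/-- The hypothesis `hp` concerns only pieces that actually appear as arguments along the way. This
allows the use inside an induction over pieces, where only the smaller pieces are known to belong to
`U`. -/
theorem reach_mem_appSet (h : System S R E) {U : Set Term}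
    (hU : ∀ x ∈ U, ∀ y, SubStep Q R E x y → y ∈ U) {s t : Term} (hs : s ∈ appSet S U)
    (hp : ∀ c d b, Reach Q R E s c → SubStep Q R E c d → Child d b → Piece R E b → b ∈ U)
    (hst : Reach Q R E s t) : t ∈ U ∨ t ∈ appSet S U := by
  induction hst with
  | refl => exact .inr hs
  | @tail c d hc hcd ih =>
    rcases ih with ih | ih
    · exact .inl (hU _ ih _ hcd)
    · have hp' := fun b => hp c d b hc hcd
      rcases hcd with hcd | hcd | hcd
      · exact step_mem_appSet h hU (List.subset_append_right _ _) (fun _ _ => .inl) ih hcd hp'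
      · exact step_mem_appSet h hU (List.subset_append_left _ _)
          (fun _ _ h => .inr (.inl h)) ih hcd hp'
      · obtain ⟨n, f, ts, hf, hts, rfl⟩ := ih
        obtain ⟨i, rfl⟩ := child_app.1 hcd
        exact .inl (hts i)

theorem reach_rStep_or_height_le (h : System S R E) {a b : Term} (hab : Reach Q R E a b) :
    (∃ u v, Reach Q R E a u ∧ RStep Q R u v ∧ Reach Q R E v b) ∨ b.height ≤ a.height := by
  induction hab with
  | refl => exact .inr le_rfl
  | @tail c d hac hcd ih =>
    rcases ih with ⟨u, v, h₁, h₂, h₃⟩ | ih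
    · exact .inl ⟨u, v, h₁, h₂, h₃.tail hcd⟩
    · rcases hcd with hcd | hcd | hcd
      · exact .inr ((hcd.height_eq h).symm.le.trans ih)
      · exact .inl ⟨c, d, hac, hcd, .refl⟩
      · exact .inr ((height_lt_of_child hcd).le.trans ih)

/-- `a` reaches a term having `b` as a proper subterm. -/
def ReachInside (S : List (ℕ × ℕ)) (Q : Term → Prop) (R E : List Rule) (b a : Term) : Prop :=
  a.Over S ∧ ∃ c d, Reach Q R E a c ∧ Child c d ∧ Reach Q R E d b

/-- Suppose a term reaches itself through a proper subterm. If a restricted step occurs on the way,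
it belongs to a loop. If none occurs, `E`-steps keep the height while the passage to an argument
lowers it. -/
theorem reachInside_isStrictOrder (h : System S R E) (hn : ¬ Loops S Q R E) :
    IsStrictOrder Term (ReachInside S Q R E) where
  irrefl := by
    rintro a ⟨ha, c, d, h₁, h₂, h₃⟩
    have hca : Reach Q R E c a := .head (.inr (.inr h₂)) h₃
    rcases reach_rStep_or_height_le h h₁ with ⟨u, v, k₁, k₂, k₃⟩ | h₄
    · exact hn ⟨u, v, SubStep.star_over h k₁ ha, k₂, k₃.trans (hca.trans k₁)⟩
    rcases reach_rStep_or_height_le h h₃ with ⟨u, v, k₁, k₂, k₃⟩ | h₅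
    · have hau : Reach Q R E a u := h₁.trans (.head (.inr (.inr h₂)) k₁)
      exact hn ⟨u, v, SubStep.star_over h hau ha, k₂, k₃.trans hau⟩
    have := height_lt_of_child h₂
    omega
  trans := by
    rintro a b c ⟨-, c', d', h₁, h₂, h₃⟩ ⟨hc, c'', d'', k₁, k₂, k₃⟩
    exact ⟨hc, c'', d'', k₁, k₂, k₃.trans (h₁.trans (.head (.inr (.inr h₂)) h₃))⟩

/-- Well-founded induction over the finite set of pieces. A piece created as an argument of a term
reached from `a` is below `a` in the order `ReachInside`, so by induction it reaches finitely many
terms. The set `U` collects these, and whatever `a` reaches is in `U` or is a function symbol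
applied to elements of `U`. -/
theorem finite_reach_piece (h : System S R E) (hn : ¬ Loops S Q R E) {a : Term}
    (ha : Piece R E a) : {t | Reach Q R E a t}.Finite := by
  have := reachInside_isStrictOrder h hn
  have hwf : {b | Piece R E b}.WellFoundedOn (ReachInside S Q R E) :=
    (finite_setOf_piece R E).wellFoundedOn
  refine hwf.induction (P := fun a => {t | Reach Q R E a t}.Finite) ha fun a ha ih => ?_
  have hao := Piece.over h ha
  set U : Set Term := ⋃ b ∈ {b | Piece R E b ∧ ReachInside S Q R E b a}, {t | Reach Q R E b t}
    with hUdef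
  have hUfin : U.Finite :=
    ((finite_setOf_piece R E).subset fun b hb => hb.1).biUnion fun b hb => ih b hb.1 hb.2
  have hmem : ∀ b, Piece R E b → ReachInside S Q R E b a → b ∈ U := fun b h₁ h₂ =>
    Set.mem_biUnion (x := b) ⟨h₁, h₂⟩ .refl
  have hUcl : ∀ x ∈ U, ∀ y, SubStep Q R E x y → y ∈ U := by
    intro x hx y hxy
    obtain ⟨b, hb, hbx⟩ := Set.mem_iUnion₂.1 hx
    exact Set.mem_biUnion hb (ReflTransGen.tail hbx hxy)
  obtain ⟨n, f, ts, rfl⟩ : ∃ n f, ∃ ts : Fin n → Term, a = app f ts := by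
    cases a with
    | var x =>
      obtain ⟨ρ, -, -, hv⟩ := ha
      exact absurd (mem_vars_var.2 rfl : x ∈ (var x).vars) (by simp [hv])
    | app f ts => exact ⟨_, f, ts, rfl⟩
  have hs : app f ts ∈ appSet S U := by
    refine ⟨n, f, ts, hao.1, fun i => ?_, rfl⟩
    exact hmem _ (ha.child (.mk f ts i)) ⟨hao, _, _, .refl, .mk f ts i, .refl⟩
  refine (hUfin.union (appSet_finite S hUfin)).subset fun t ht => ?_
  exact reach_mem_appSet h hUcl hs (fun c d b h₁ h₂ h₃ h₄ =>
    hmem b h₄ ⟨hao, d, b, h₁.tail h₂, h₃, .refl⟩) ht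

theorem finite_reach (h : System S R E) (hn : ¬ Loops S Q R E) {s : Term} (hs : s.Over S) :
    {t | Reach Q R E s t}.Finite := by
  induction s with
  | var x =>
    refine (Set.finite_singleton (var x)).subset fun t ht => ?_
    rcases ReflTransGen.cases_head ht with h' | ⟨c, h' | h' | h', -⟩
    · exact h'.symm
    · exact absurd h' (not_rStep_var h.goodE)
    · exact absurd h' (not_rStep_var h.goodR)
    · exact absurd h' not_child_var
  | @app n f ts ih =>
    set U : Set Term := (⋃ b ∈ {b | Piece R E b}, {t | Reach Q R E b t}) ∪
      ⋃ i, {t | Reach Q R E (ts i) t}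
    have hUfin : U.Finite :=
      ((finite_setOf_piece R E).biUnion fun b hb => finite_reach_piece h hn hb).union
        (Set.finite_iUnion fun i => ih i (hs.2 i))
    have hUcl : ∀ x ∈ U, ∀ y, SubStep Q R E x y → y ∈ U := by
      rintro x (hx | hx) y hxy
      · obtain ⟨b, hb, hbx⟩ := Set.mem_iUnion₂.1 hx
        exact .inl (Set.mem_biUnion hb (ReflTransGen.tail hbx hxy))
      · obtain ⟨i, hi⟩ := Set.mem_iUnion.1 hx
        exact .inr (Set.mem_iUnion.2 ⟨i, ReflTransGen.tail hi hxy⟩)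
    refine (hUfin.union (appSet_finite S hUfin)).subset fun t ht => ?_
    refine reach_mem_appSet h hUcl ⟨n, f, ts, hs.1, fun i => ?_, rfl⟩
      (fun c d b _ _ _ hb => ?_) ht
    · exact .inr (Set.mem_iUnion.2 ⟨i, .refl⟩)
    · exact .inl (Set.mem_biUnion (x := b) hb .refl)

/-! ### A rank on terms -/

/-- The terms reachable with at least one restricted step. -/
def strictReach (Q : Term → Prop) (R E : List Rule) (t : Term) : Set Term :=
  {v | ∃ u w, Reach Q R E t u ∧ RStep Q R u w ∧ Reach Q R E w v}

/-- The number of terms reachable with at least one restricted step. -/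
noncomputable def stepRank (Q : Term → Prop) (R E : List Rule) (t : Term) : ℕ :=
  (strictReach Q R E t).ncard

theorem strictReach_finite (h : System S R E) (hn : ¬ Loops S Q R E) {t : Term}
    (ht : t.Over S) : (strictReach Q R E t).Finite := by
  refine (finite_reach h hn ht).subset ?_
  rintro v ⟨u, w, h₁, h₂, h₃⟩
  exact ReflTransGen.trans h₁ (.head (.inr (.inl h₂)) h₃)

theorem strictReach_subset {s t : Term} (hst : Reach Q R E s t) :
    strictReach Q R E t ⊆ strictReach Q R E s := by
  rintro v ⟨u, w, h₁, h₂, h₃⟩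
  exact ⟨u, w, ReflTransGen.trans hst h₁, h₂, h₃⟩

theorem stepRank_le (h : System S R E) (hn : ¬ Loops S Q R E) {s t : Term}
    (hs : s.Over S) (hst : Reach Q R E s t) : stepRank Q R E t ≤ stepRank Q R E s :=
  Set.ncard_le_ncard (strictReach_subset hst) (strictReach_finite h hn hs)

/-- The term `t` itself makes the inclusion strict: it is reached from `s` with at least one
restricted step, and if it were so reached from `t`, there would be a loop. -/
theorem stepRank_lt (h : System S R E) (hn : ¬ Loops S Q R E) {s t : Term}
    (hs : s.Over S) (hst : RStep Q R s t) : stepRank Q R E t < stepRank Q R E s := by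
  have hr : Reach Q R E s t := .single (.inr (.inl hst))
  refine Set.ncard_lt_ncard ((Set.ssubset_iff_of_subset (strictReach_subset hr)).2
    ⟨t, ⟨s, t, .refl, hst, .refl⟩, ?_⟩) (strictReach_finite h hn hs)
  rintro ⟨u, w, h₁, h₂, h₃⟩
  exact hn ⟨u, w, SubStep.star_over h (hr.trans h₁) hs, h₂, ReflTransGen.trans h₃ h₁⟩

theorem reach_of_eStar {s t : Term} (h : ReflTransGen (EStep E) s t) : Reach Q R E s t :=
  ReflTransGen.mono (fun _ _ => .inl) _ _ h

theorem sn_of_not_loops (h : System S R E) (hn : ¬ Loops S Q R E) {s : Term} (hs : s.Over S) :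
    SN Q R E s := by
  induction hk : stepRank Q R E s using Nat.strong_induction_on generalizing s with
  | _ k ih =>
    refine Acc.intro _ fun t ⟨u, v, h₁, h₂, h₃⟩ => ?_
    have r₁ : Reach Q R E s u := reach_of_eStar h₁
    have ou := SubStep.star_over h r₁ hs
    have r₂ : Reach Q R E u v := .single (.inr (.inl h₂))
    have r₃ : Reach Q R E v t := reach_of_eStar h₃
    have ov := SubStep.star_over h r₂ ou
    refine ih _ ?_ (SubStep.star_over h r₃ ov) rfl
    have l₁ := stepRank_le h hn hs r₁
    have l₂ := stepRank_lt h hn ou h₂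
    have l₃ := stepRank_le h hn ov r₃
    omega

end

end RewritingModulo
-- Well-foundedness modulo `E`, and reduction to terms with arguments from a fixed set.
namespace RewritingModulo

open Relation Term

/-! ### A well-founded relation on classes of terms modulo `E` -/

section Below

variable {S : List (ℕ × ℕ)} {Q : Term → Prop} {R E : List Rule}

theorem eStar_of_mk_eq (h : System S R E) {a b : Term}
    (hab : Quot.mk (EStep E) a = Quot.mk (EStep E) b) : ReflTransGen (EStep E) a b := by
  have hsymm : ∀ {x y}, ReflTransGen (EStep E) x y → ReflTransGen (EStep E) y x := by
    intro x y hxy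
    induction hxy with
    | refl => exact .refl
    | tail _ h' ih => exact .head (h'.symm h) ih
  induction Quot.eqvGen_exact hab with
  | rel _ _ h' => exact .single h'
  | refl => exact .refl
  | symm _ _ _ ih => exact hsymm (ih (Quot.eqvGen_sound ‹_›))
  | trans _ _ _ _ _ ih₁ ih₂ =>
    exact (ih₁ (Quot.eqvGen_sound ‹_›)).trans (ih₂ (Quot.eqvGen_sound ‹_›))

/-- A class is below the class of a strongly normalizing term if it is obtained by a step or by
taking a proper subterm. -/
def Below (Q : Term → Prop) (R E : List Rule) (q' q : Quot (EStep E)) : Prop :=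
  ∃ a a', SN Q R E a ∧ Quot.mk _ a = q ∧ Quot.mk _ a' = q' ∧
    (RStep Q R a a' ∨ TransGen Child a a')

theorem height_lt_of_transGen {a b : Term} (h : TransGen Child a b) : b.height < a.height := by
  obtain ⟨c, h₁, h₂⟩ := TransGen.head'_iff.1 h
  exact (height_le_of_sub h₂).trans_lt (height_lt_of_child h₁)

/-- A lexicographic induction, first on a strongly normalizing term surrounding `u`, then on the
height of `u`. A restricted step of the subterm lifts to the surrounding term; a passage to a proper
subterm lowers the height, which is the same for all representatives of a class. -/
theorem SN.acc_below (h : System S R E) {t : Term} (ht : SN Q R E t) :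
    ∀ {t₁ u}, ReflTransGen (EStep E) t t₁ → ReflTransGen Child t₁ u →
      Acc (Below Q R E) (Quot.mk _ u) := by
  induction ht with
  | intro t _ ih =>
    intro t₁ u h₁ hu
    induction hk : u.height using Nat.strong_induction_on generalizing t₁ u with
    | _ k ihk =>
      refine Acc.intro _ ?_
      rintro _ ⟨a, a', -, ha, rfl, haa'⟩
      have hua := eStar_of_mk_eq h ha.symm
      obtain ⟨t₂, h₂, hs₂⟩ := CtxStep.lift_star hu hua
      rcases haa' with haa' | haa'
      · obtain ⟨t₃, h₃, hs₃⟩ := CtxStep.lift hs₂ haa'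
        exact ih t₃ ⟨t₂, t₃, h₁.trans h₂, h₃, .refl⟩ .refl hs₃
      · refine ihk _ ?_ (h₁.trans h₂) (hs₂.trans haa'.to_reflTransGen) rfl
        have hheight : u.height = a.height := by
          clear ha hu h₂ hk hs₂ haa'
          induction hua with
          | refl => rfl
          | tail _ h' ih' => exact ih'.trans (h'.height_eq h)
        have := height_lt_of_transGen haa'
        omega

/-- Since `Below` demands a strongly normalizing representative of the upper class, a class with any
predecessor at all is covered by `SN.acc_below`. -/
theorem wellFounded_below (h : System S R E) : WellFounded (Below Q R E) := by
  refine ⟨fun q => Acc.intro _ fun q' hq => ?_⟩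
  have hq' := hq
  obtain ⟨a, a', ha, rfl, rfl, -⟩ := hq
  exact (ha.acc_below h .refl .refl).inv hq'

theorem SN.reach {s t : Term} (hs : SN Q R E s) (hst : Reach Q R E s t) : SN Q R E t := by
  induction hst with
  | refl => exact hs
  | tail _ h' ih =>
    rcases h' with h' | h' | h'
    · exact ih.eStep h'
    · exact ih.rStep h'
    · exact ih.sub (.single h')

theorem SN.reflTransGen_below {s t : Term} (hs : SN Q R E s) (hst : Reach Q R E s t) :
    ReflTransGen (Below Q R E) (Quot.mk _ t) (Quot.mk _ s) := by
  induction hst with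
  | refl => exact .refl
  | @tail b c hsb h' ih =>
    have hb := hs.reach hsb
    rcases h' with h' | h' | h'
    · rwa [← Quot.sound h']
    · exact .head ⟨b, c, hb, rfl, rfl, .inl h'⟩ ih
    · exact .head ⟨b, c, hb, rfl, rfl, .inr (.single h')⟩ ih

/-- A loop becomes a cycle of `Below`: its first step is strict, and its `E`-steps disappear in the
quotient. -/
theorem not_loops_of_sn (h : System S R E) (hs : ∀ s : Term, s.Over S → SN Q R E s) :
    ¬ Loops S Q R E := by
  rintro ⟨u, v, hu, huv, hvu⟩
  have hsn := hs u hu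
  have h₁ : TransGen (Below Q R E) (Quot.mk _ u) (Quot.mk _ u) :=
    TransGen.tail' ((hsn.rStep huv).reflTransGen_below hvu) ⟨u, v, hsn, rfl, rfl, .inl huv⟩
  exact (wellFounded_below h).transGen.irrefl.irrefl _ h₁

end Below

/-! ### Sums of multisets and `CutExpand` -/

section CutExpand

variable {α ι : Type*} {r : α → α → Prop}

theorem reflTransGen_cutExpand_sum (s : Finset ι) (A B : ι → Multiset α)
    (h : ∀ i ∈ s, ReflTransGen (CutExpand r) (A i) (B i)) :
    ReflTransGen (CutExpand r) (∑ i ∈ s, A i) (∑ i ∈ s, B i) := by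
  classical
  induction s using Finset.induction_on with
  | empty => simpa using .refl
  | insert i s hi ih =>
    rw [Finset.sum_insert hi, Finset.sum_insert hi]
    refine ReflTransGen.trans (b := A i + ∑ i ∈ s, B i) ?_ ?_
    · exact ReflTransGen.lift (A i + ·) (fun _ _ => (cutExpand_add_left _).2) _ _
        (ih fun j hj => h j (Finset.mem_insert_of_mem hj))
    · exact ReflTransGen.lift (· + ∑ i ∈ s, B i) (fun _ _ => (cutExpand_add_right _).2) _ _
        (h i (Finset.mem_insert_self i s))

theorem transGen_cutExpand_sum (s : Finset ι) (A B : ι → Multiset α)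
    (h : ∀ i ∈ s, ReflTransGen (CutExpand r) (A i) (B i)) {i : ι} (hi : i ∈ s)
    (hlt : TransGen (CutExpand r) (A i) (B i)) :
    TransGen (CutExpand r) (∑ i ∈ s, A i) (∑ i ∈ s, B i) := by
  classical
  rw [← Finset.add_sum_erase s A hi, ← Finset.add_sum_erase s B hi]
  refine TransGen.trans_right (b := A i + ∑ i ∈ s.erase i, B i) ?_ ?_
  · exact ReflTransGen.lift (A i + ·) (fun _ _ => (cutExpand_add_left _).2) _ _
      (reflTransGen_cutExpand_sum _ A B fun j hj => h j (Finset.mem_of_mem_erase hj))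
  · exact TransGen.lift (· + ∑ i ∈ s.erase i, B i) (fun _ _ => (cutExpand_add_right _).2) _ _ hlt

end CutExpand

/-! ### Abstraction of arguments by a variable -/

section Abstraction

open Classical in
/-- The marked arguments are replaced by a variable. -/
noncomputable def absArgs {n : ℕ} (ts : Fin n → Term) (old : Fin n → Prop) (i : Fin n) : Term :=
  if old i then var 0 else ts i

open Classical in
/-- The classes of the marked arguments. -/
noncomputable def oldArgs (E : List Rule) {n : ℕ} (ts : Fin n → Term) (old : Fin n → Prop) :
    Multiset (Quot (EStep E)) :=
  ∑ i, if old i then {Quot.mk _ (ts i)} else 0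

variable {S : List (ℕ × ℕ)} {Q : Term → Prop} {R E : List Rule} {N : Set Term}

/-- A term with strongly normalizing arguments whose unmarked arguments belong to `N`. -/
structure Marked (S : List (ℕ × ℕ)) (Q : Term → Prop) (R E : List Rule) (N : Set Term) {n : ℕ}
    (f : ℕ) (ts : Fin n → Term) (old : Fin n → Prop) : Prop where
  mem : (n, f) ∈ S
  sn : ∀ i, SN Q R E (ts i)
  new : ∀ i, ¬ old i → ts i ∈ N

/-- A set of strongly normalizing terms over `S` that contains `var 0` and the variable-free
subterms of right-hand sides and is closed under steps and arguments. -/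
structure Base (S : List (ℕ × ℕ)) (Q : Term → Prop) (R E : List Rule) (N : Set Term) : Prop where
  var_mem : var 0 ∈ N
  piece_mem : ∀ b, Piece R E b → b ∈ N
  closed : ∀ x ∈ N, ∀ y, SubStep Q R E x y → y ∈ N
  sn : ∀ x ∈ N, SN Q R E x

/-- Each old argument of the contractum is charged, by `pick`, to one old argument of the redex that
contains it. An old argument matched by a variable is charged at most once, by right-linearity; any
other is charged only with proper subterms of itself. So the multiset of old classes drops unless
every old argument is matched by a variable and charged. In that case the variables concerned can be
instantiated by `var 0`, which yields the same step between the abstracted terms. A variable that is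
repeated on the left and occurs in an old argument always leads to a drop, so left-linearity is not
needed. -/
theorem Marked.rootStep (h : System S R E) (hN : Base S Q R E N) {Q' : Term → Prop}
    (hQ' : Q' (var 0)) {R' : List Rule} (hR' : R' ⊆ R ++ E) {n f : ℕ} {ts : Fin n → Term}
    {old : Fin n → Prop} (hm : Marked S Q R E N f ts old) {v : Term}
    (hst : RootStep Q' R' (app f ts) v) :
    SN Q R E v ∨ ∃ m g, ∃ us : Fin m → Term, ∃ old', v = app g us ∧
      Marked S Q R E N g us old' ∧
        (TransGen (CutExpand (Below Q R E)) (oldArgs E us old') (oldArgs E ts old) ∨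
          oldArgs E us old' = oldArgs E ts old ∧
            RootStep Q' R' (app f (absArgs ts old)) (app g (absArgs us old'))) := by
  classical
  obtain ⟨ρ, hρ, σ, h₁, rfl, h₃⟩ := hst
  have hg := h.good ρ (hR' hρ)
  obtain ⟨n', f', ls, hl⟩ := hg.lhs
  rw [hl] at h₁
  simp only [subst] at h₁
  obtain ⟨rfl, rfl, hts⟩ := Term.app.inj h₁
  replace hts : ts = fun i => (ls i).subst σ := eq_of_heq hts
  have hts' : ∀ i, ts i = (ls i).subst σ := fun i => congrFun hts i
  cases hr : ρ.2 with
  | var x =>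
    left
    obtain ⟨w, hw, hs⟩ := hg.child_sub (σ := σ) (x := x) (by rw [hr]; rfl)
    rw [hl] at hw
    obtain ⟨i, rfl⟩ := child_app.1 hw
    rw [← hts' i] at hs
    exact (hm.sn i).sub hs
  | @app m g rs =>
    right
    have hmg : (m, g) ∈ S := by
      have := hg.isRewriteRule.2.1
      rw [hr] at this
      exact this.1
    have hlin := hg.linear _ _ _ hr
    have hsh := hg.shallow _ _ _ hr
    have hvars := hg.isRewriteRule.2.2.2
    have hpiece : ∀ j, (rs j).vars = ∅ → Piece R E (rs j) := fun j hj =>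
      ⟨ρ, hR' hρ, by rw [hr]; exact .single (.mk g rs j), hj⟩
    rw [hr, hl] at hvars
    have hrv : ∀ j x, rs j = var x → ∃ i, x ∈ (ls i).vars := by
      intro j x hj
      exact mem_vars_app.1 (hvars (mem_vars_app.2 ⟨j, by rw [hj]; rfl⟩))
    have hsub : ∀ i x, x ∈ (ls i).vars → ReflTransGen Child (ts i) (σ x) := by
      intro i x hx
      rw [hts' i]
      exact sub_subst hx
    -- A variable that also occurs in an unmarked argument takes its value from `N`, so it does not
    -- count as old.
    set oldVar : ℕ → Prop := fun x => ∀ i, x ∈ (ls i).vars → old i with holdVar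
    set old' : Fin m → Prop := fun j => ∃ x, rs j = var x ∧ oldVar x with hold'
    set us : Fin m → Term := fun j => (rs j).subst σ with hus
    -- An old variable may occur in several old arguments. Choosing one of them lets the sum over
    -- the new arguments be regrouped by the arguments of the redex.
    have hpick : ∀ j, ∃ o : Option (Fin n), (¬ old' j → o = none) ∧
        (∀ i, o = some i → old' j ∧ ∃ x, rs j = var x ∧ x ∈ (ls i).vars ∧ old i) ∧
        (old' j → ∃ i, o = some i) := by
      intro j
      by_cases hj : old' j
      · obtain ⟨x, hx, hox⟩ := id hj
        obtain ⟨i, hi⟩ := hrv j x hx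
        refine ⟨some i, fun h => absurd hj h, fun i' hi' => ⟨hj, x, hx, ?_⟩, fun _ => ⟨i, rfl⟩⟩
        cases hi'
        exact ⟨hi, hox i hi⟩
      · exact ⟨none, fun _ => rfl, fun i hi => by simp at hi, fun h => absurd h hj⟩
    choose pick hp₁ hp₂ hp₃ using hpick
    have husx : ∀ j x, rs j = var x → us j = σ x := by
      intro j x hj
      simp only [hus, hj, subst]
    set K : Fin n → Multiset (Quot (EStep E)) :=
      fun i => ∑ j, if pick j = some i then {Quot.mk _ (us j)} else 0 with hK
    have hsum : oldArgs E us old' = ∑ i, K i := by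
      rw [oldArgs, hK, Finset.sum_comm]
      refine Finset.sum_congr rfl fun j _ => ?_
      by_cases hj : old' j
      · obtain ⟨i, hi⟩ := hp₃ j hj
        simp [hj, hi]
      · simp [hj, hp₁ j hj]
    have hnot : ∀ i, ¬ old i → K i = 0 := by
      intro i hi
      refine Finset.sum_eq_zero fun j _ => ?_
      rw [if_neg]
      intro hj
      obtain ⟨-, x, -, -, h'⟩ := hp₂ j i hj
      exact hi h'
    set P : Fin n → Prop := fun i => ∃ j x, ls i = var x ∧ pick j = some i with hP
    have hKP : ∀ i, P i → K i = {Quot.mk _ (ts i)} := by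
      rintro i ⟨j, x, hx, hj⟩
      have hval : ∀ j, pick j = some i → rs j = var x := by
        intro j hj
        obtain ⟨-, y, hy, hyi, -⟩ := hp₂ j i hj
        rw [hx, mem_vars_var] at hyi
        rw [hy, hyi]
      simp only [hK]
      rw [Finset.sum_eq_single j]
      · rw [if_pos hj, husx j x (hval j hj), hts' i, hx]
        rfl
      · intro j' _ hne
        rw [if_neg]
        intro hj'
        -- Right-linearity: two places charged to `i` would both hold the variable `x`.
        exact hne (hlin _ _ _ (hval j' hj') (hval j hj))
      · simp
    have hKn : ∀ i, ¬ P i → CutExpand (Below Q R E) (K i) {Quot.mk _ (ts i)} := by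
      intro i hi
      refine cutExpand_singleton fun a ha => ?_
      obtain ⟨j, -, hj⟩ := Multiset.mem_sum.1 ha
      by_cases hpj : pick j = some i
      · rw [if_pos hpj, Multiset.mem_singleton] at hj
        subst hj
        obtain ⟨-, x, hx, hxi, -⟩ := hp₂ j i hpj
        refine ⟨ts i, us j, hm.sn i, rfl, rfl, .inr ?_⟩
        rw [husx j x hx, hts' i]
        cases hli : ls i with
        | var y => exact absurd ⟨j, y, hli, hpj⟩ hi
        | app k ws =>
          rw [hli] at hxi
          obtain ⟨l, hxl⟩ := mem_vars_app.1 hxi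
          exact TransGen.head' (.mk k (fun i => (ws i).subst σ) l) (sub_subst hxl)
      · simp [hpj] at hj
    have hle : ∀ i ∈ Finset.univ, ReflTransGen (CutExpand (Below Q R E)) (K i)
        (if old i then {Quot.mk _ (ts i)} else 0) := by
      intro i _
      by_cases hi : old i
      · rw [if_pos hi]
        by_cases hPi : P i
        · rw [hKP i hPi]
        · exact .single (hKn i hPi)
      · rw [if_neg hi, hnot i hi]
    have hmark : Marked S Q R E N g us old' := by
      refine ⟨hmg, fun j => ?_, fun j hj => ?_⟩
      · rcases hsh j with ⟨x, hx⟩ | hv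
        · obtain ⟨i, hi⟩ := hrv j x hx
          rw [husx j x hx]
          exact (hm.sn i).sub (hsub i x hi)
        · simp only [hus]
          rw [subst_of_vars_eq_empty hv]
          exact hN.sn _ (hN.piece_mem _ (hpiece j hv))
      · rcases hsh j with ⟨x, hx⟩ | hv
        · have : ∃ i, x ∈ (ls i).vars ∧ ¬ old i := by
            by_contra hcon
            push Not at hcon
            exact hj ⟨x, hx, hcon⟩
          obtain ⟨i, hi, hoi⟩ := this
          rw [husx j x hx]
          exact mem_of_sub hN.closed (hm.new i hoi) (hsub i x hi)
        · simp only [hus]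
          rw [subst_of_vars_eq_empty hv]
          exact hN.piece_mem _ (hpiece j hv)
    refine ⟨m, g, us, old', rfl, hmark, ?_⟩
    by_cases hall : ∀ i, old i → P i
    · right
      -- The same rule applies to the abstracted terms, with `σ` changed to `var 0` at the old
      -- variables.
      refine ⟨?_, ρ, hρ, fun x => if oldVar x then var 0 else σ x, ?_, ?_, ?_⟩
      · rw [hsum, oldArgs]
        refine Finset.sum_congr rfl fun i _ => ?_
        by_cases hi : old i
        · rw [if_pos hi, hKP i (hall i hi)]
        · rw [if_neg hi, hnot i hi]
      · rw [hl]
        simp only [subst]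
        congr 1
        funext i
        by_cases hi : old i
        · obtain ⟨j, x, hx, hj⟩ := hall i hi
          obtain ⟨⟨y, hy, hoy⟩, z, hz, hzi, -⟩ := hp₂ j i hj
          rw [hx, mem_vars_var] at hzi
          have hyx : y = x := by
            rw [hz] at hy
            cases hy
            exact hzi
          subst hyx
          simp [absArgs, hi, hx, subst, hoy]
        · rw [absArgs, if_neg hi, hts' i]
          refine subst_congr fun x hx => ?_
          rw [if_neg]
          exact fun hox => hi (hox i hx)
      · rw [hr]
        simp only [subst]
        congr 1
        funext j
        by_cases hj : old' j
        · obtain ⟨x, hx, hox⟩ := id hj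
          simp [absArgs, hj, hx, subst, hox]
        · rw [absArgs, if_neg hj]
          refine subst_congr fun x hx => ?_
          rw [if_neg]
          intro hox
          rcases hsh j with ⟨y, hy⟩ | hv
          · rw [hy, mem_vars_var] at hx
            subst hx
            exact hj ⟨_, hy, hox⟩
          · simp [hv] at hx
      · intro w hw
        obtain ⟨i, rfl⟩ := child_app.1 hw
        by_cases hi : old i
        · simpa [absArgs, hi] using hQ'
        · simpa [absArgs, hi] using h₃ _ (.mk f ts i)
    · left
      push Not at hall
      obtain ⟨i, hi, hPi⟩ := hall
      rw [hsum, oldArgs]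
      refine transGen_cutExpand_sum _ _ _ hle (Finset.mem_univ i) ?_
      rw [if_pos hi]
      exact .single (hKn i hPi)

theorem Marked.update {n f : ℕ} {ts : Fin n → Term} {old : Fin n → Prop}
    (hm : Marked S Q R E N f ts old) {i : Fin n} {t : Term} (ht : SN Q R E t)
    (hnew : ¬ old i → t ∈ N) : Marked S Q R E N f (Function.update ts i t) old := by
  refine ⟨hm.mem, fun j => ?_, fun j hj => ?_⟩
  · by_cases hji : j = i
    · subst hji; simpa using ht
    · simpa [hji] using hm.sn j
  · by_cases hji : j = i
    · subst hji; simpa using hnew hj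
    · simpa [hji] using hm.new j hj

theorem absArgs_update_of_old {n : ℕ} {ts : Fin n → Term} {old : Fin n → Prop} {i : Fin n}
    {t : Term} (hi : old i) : absArgs (Function.update ts i t) old = absArgs ts old := by
  funext j
  by_cases hji : j = i
  · subst hji; simp [absArgs, hi]
  · simp [absArgs, hji]

theorem absArgs_update_of_not_old {n : ℕ} {ts : Fin n → Term} {old : Fin n → Prop} {i : Fin n}
    {t : Term} (hi : ¬ old i) :
    absArgs (Function.update ts i t) old = Function.update (absArgs ts old) i t := by
  funext j
  by_cases hji : j = i
  · subst hji; simp [absArgs, hi]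
  · simp [absArgs, hji]

theorem oldArgs_update_of_eq {n : ℕ} {ts : Fin n → Term} {old : Fin n → Prop} {i : Fin n}
    {t : Term} (ht : old i → Quot.mk (EStep E) t = Quot.mk _ (ts i)) :
    oldArgs E (Function.update ts i t) old = oldArgs E ts old := by
  refine Finset.sum_congr rfl fun j _ => ?_
  by_cases hji : j = i
  · subst hji
    by_cases hj : old j
    · simp [hj, ht hj]
    · simp [hj]
  · simp [hji]

theorem cutExpand_oldArgs_update {n : ℕ} {ts : Fin n → Term} {old : Fin n → Prop} {i : Fin n}
    {t : Term} (hi : old i) (ht : Below Q R E (Quot.mk _ t) (Quot.mk _ (ts i))) :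
    TransGen (CutExpand (Below Q R E)) (oldArgs E (Function.update ts i t) old)
      (oldArgs E ts old) := by
  refine transGen_cutExpand_sum _ _ _ (fun j _ => ?_) (Finset.mem_univ i) ?_
  · by_cases hji : j = i
    · subst hji
      simp only [Function.update_self, hi, if_true]
      exact .single (cutExpand_singleton_singleton ht)
    · simp only [ne_eq, hji, not_false_eq_true, Function.update_of_ne]
      exact .refl
  · simp only [Function.update_self, hi, if_true]
    exact .single (cutExpand_singleton_singleton ht)

/-- Steps from marked terms make the marked arguments smaller or are reflected by the terms in
which the marked arguments are replaced by a variable. -/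
theorem Marked.eStep (h : System S R E) (hN : Base S Q R E N) {n f : ℕ}
    {ts : Fin n → Term} {old : Fin n → Prop} (hm : Marked S Q R E N f ts old) {v : Term}
    (hst : EStep E (app f ts) v) :
    SN Q R E v ∨ ∃ m g, ∃ us : Fin m → Term, ∃ old', v = app g us ∧
      Marked S Q R E N g us old' ∧
        (TransGen (CutExpand (Below Q R E)) (oldArgs E us old') (oldArgs E ts old) ∨
          oldArgs E us old' = oldArgs E ts old ∧
            ReflTransGen (EStep E) (app f (absArgs ts old)) (app g (absArgs us old'))) := by
  cases hst with
  | root hst =>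
    refine (hm.rootStep h hN trivial (List.subset_append_right _ _) hst).imp_right ?_
    rintro ⟨m, g, us, old', h₁, h₂, h₃⟩
    exact ⟨m, g, us, old', h₁, h₂, h₃.imp_right fun h₃ => ⟨h₃.1, .single (.root h₃.2)⟩⟩
  | @arg _ _ _ i t hst =>
    refine .inr ⟨n, f, _, old, rfl, hm.update ((hm.sn i).eStep hst)
      (fun hi => hN.closed _ (hm.new i hi) _ (.inl hst)), .inr ⟨?_, ?_⟩⟩
    · exact oldArgs_update_of_eq fun _ => (Quot.sound hst).symm
    · by_cases hi : old i
      · rw [absArgs_update_of_old hi]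
      · rw [absArgs_update_of_not_old hi]
        refine .single (.arg f _ i ?_)
        simpa [absArgs, hi] using hst

/-- A step inside an old argument is invisible after abstraction but lowers its class in `Below`; a
step inside an unmarked argument is retained by the abstraction. -/
theorem Marked.rStep (h : System S R E) (hN : Base S Q R E N) (hQ : Q (var 0)) {n f : ℕ}
    {ts : Fin n → Term} {old : Fin n → Prop} (hm : Marked S Q R E N f ts old) {v : Term}
    (hst : RStep Q R (app f ts) v) :
    SN Q R E v ∨ ∃ m g, ∃ us : Fin m → Term, ∃ old', v = app g us ∧
      Marked S Q R E N g us old' ∧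
        (TransGen (CutExpand (Below Q R E)) (oldArgs E us old') (oldArgs E ts old) ∨
          oldArgs E us old' = oldArgs E ts old ∧
            RStep Q R (app f (absArgs ts old)) (app g (absArgs us old'))) := by
  cases hst with
  | root hst =>
    refine (hm.rootStep h hN hQ (List.subset_append_left _ _) hst).imp_right ?_
    rintro ⟨m, g, us, old', h₁, h₂, h₃⟩
    exact ⟨m, g, us, old', h₁, h₂, h₃.imp_right fun h₃ => ⟨h₃.1, .root h₃.2⟩⟩
  | @arg _ _ _ i t hst =>
    refine .inr ⟨n, f, _, old, rfl, hm.update ((hm.sn i).rStep hst)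
      (fun hi => hN.closed _ (hm.new i hi) _ (.inr (.inl hst))), ?_⟩
    by_cases hi : old i
    · exact .inl (cutExpand_oldArgs_update hi ⟨_, _, hm.sn i, rfl, rfl, .inl hst⟩)
    · refine .inr ⟨oldArgs_update_of_eq fun h => absurd h hi, ?_⟩
      rw [absArgs_update_of_not_old hi]
      refine .arg f _ i ?_
      simpa [absArgs, hi] using hst

/-- Three nested inductions: on the multiset of old classes, on the strongly normalizing term `a`,
and on the `E`-steps before the next `R`-step. When the multiset drops, the abstraction of the new
term takes over, normalizing by `hbase`. When it stays, an `R`-step is reflected and makes `a`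
smaller. The abstraction is tied to `a` only by `E`-steps from `a`, since it may change under `E`
without progress. -/
theorem Marked.sn_app (h : System S R E) (hN : Base S Q R E N) (hQ : Q (var 0))
    (hbase : ∀ {m g : ℕ} {us : Fin m → Term}, (m, g) ∈ S → (∀ j, us j ∈ N) →
      SN Q R E (app g us)) :
    ∀ (M : Multiset (Quot (EStep E))) (a : Term), SN Q R E a →
      ∀ {n f : ℕ} {ts : Fin n → Term} {old : Fin n → Prop}, Marked S Q R E N f ts old →
        oldArgs E ts old = M → ReflTransGen (EStep E) a (app f (absArgs ts old)) →
        SN Q R E (app f ts) := by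
  intro M
  induction M using (wellFounded_below (Q := Q) h).cutExpand.transGen.induction with
  | _ M ihM =>
  intro a ha
  induction ha with
  | intro a _ iha =>
  intro n f ts old hm hM hE
  have hlow : ∀ {m g : ℕ} {us : Fin m → Term} {old' : Fin m → Prop},
      Marked S Q R E N g us old' →
      TransGen (CutExpand (Below Q R E)) (oldArgs E us old') M → SN Q R E (app g us) := by
    intro m g us old' hm' hlt
    refine ihM _ hlt (app g (absArgs us old')) (hbase hm'.mem fun j => ?_) hm' rfl .refl
    by_cases hj : old' j
    · simpa [absArgs, hj] using hN.var_mem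
    · simpa [absArgs, hj] using hm'.new j hj
  refine Acc.intro _ fun w hw => ?_
  obtain ⟨u, v, h₁, h₂, h₃⟩ := hw
  generalize hs : app f ts = s at h₁
  induction h₁ using ReflTransGen.head_induction_on generalizing n f ts old with
  | refl =>
    subst hs
    refine SN.eStar ?_ h₃
    rcases hm.rStep h hN hQ h₂ with h₄ | ⟨m, g, us, old', rfl, hm', h₄ | ⟨h₄, h₅⟩⟩
    · exact h₄
    · exact hlow hm' (hM ▸ h₄)
    · exact iha _ ⟨_, _, hE, h₅, .refl⟩ hm' (h₄.trans hM) .refl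
  | head h₄ h₅ ih =>
    subst hs
    rcases hm.eStep h hN h₄ with h₆ | ⟨m, g, us, old', rfl, hm', h₆ | ⟨h₆, h₇⟩⟩
    · exact h₆.inv ⟨u, v, h₅, h₂, h₃⟩
    · exact (hlow hm' (hM ▸ h₆)).inv ⟨u, v, h₅, h₂, h₃⟩
    · exact ih hm' (h₆.trans hM) (hE.trans h₇) rfl

theorem SN.var (h : System S R E) {x : ℕ} : SN Q R E (var x) := by
  refine Acc.intro _ fun w ⟨u, v, h₁, h₂, h₃⟩ => ?_
  rcases ReflTransGen.cases_head h₁ with rfl | ⟨c, h', -⟩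
  · exact absurd h₂ (not_rStep_var h.goodR)
  · exact absurd h' (not_rStep_var h.goodE)

/-- If all terms with arguments in `N` are strongly normalizing, then all terms are. -/
theorem Base.sn_of_over (h : System S R E) (hN : Base S Q R E N) (hQ : Q (var 0))
    (hbase : ∀ {m g : ℕ} {us : Fin m → Term}, (m, g) ∈ S → (∀ j, us j ∈ N) →
      SN Q R E (app g us)) {s : Term} (hs : s.Over S) : SN Q R E s := by
  induction s with
  | var x => exact SN.var h
  | @app n f ts ih =>
    -- At the start every argument is old, so the abstraction has only `var 0` as arguments.
    have hm : Marked S Q R E N f ts fun _ => True :=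
      ⟨hs.1, fun i => ih i (hs.2 i), fun i hi => absurd trivial hi⟩
    refine Marked.sn_app h hN hQ hbase _ _ (hbase hs.1 fun j => ?_) hm rfl .refl
    simpa [absArgs] using hN.var_mem

end Abstraction

end RewritingModulo
-- Primitive recursive computation of rewrite steps.
namespace RewritingModulo

open Relation Term Encodable

/-! ### Primitive recursive functions on terms -/

namespace Term

/-- The application of a function symbol to a list of arguments. -/
def mkApp (f : ℕ) (l : List Term) : Term := app f fun i : Fin l.length => l.get i

/-- The list of arguments. -/
def args : Term → List Term
  | var _ => []
  | app _ ts => List.ofFn ts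

/-- The head of a term together with its arguments. -/
def dest : Term → ℕ ⊕ (ℕ × List Term)
  | var x => .inl x
  | app f ts => .inr (f, List.ofFn ts)

theorem encode_map_code (l : List Term) : encode (l.map code) = encode l := by
  induction l with
  | nil => rfl
  | cons a l ih =>
    rw [List.map_cons, encode_list_cons, encode_list_cons, ih]
    rfl

theorem code_app {n : ℕ} (f : ℕ) (ts : Fin n → Term) :
    code (app f ts) = 2 * Nat.pair f (encode (List.ofFn ts)) + 1 := by
  rw [code, ← encode_map_code, List.map_ofFn]
  rfl

theorem code_mkApp (f : ℕ) (l : List Term) :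
    code (mkApp f l) = 2 * Nat.pair f (encode l) + 1 := by
  rw [mkApp, code_app]
  exact congrArg (fun m : List Term => 2 * Nat.pair f (encode m) + 1) (List.ofFn_get l)

theorem mkApp_ofFn {n : ℕ} (f : ℕ) (ts : Fin n → Term) : mkApp f (List.ofFn ts) = app f ts :=
  code_injective (by rw [code_mkApp, code_app])

theorem mem_args {s t : Term} : t ∈ args s ↔ Child s t := by
  cases s with
  | var x => simp [args, not_child_var]
  | app f ts => simp [args, child_app, List.mem_ofFn]

theorem code_lt_of_child {s t : Term} (h : Child s t) : code t < code s := by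
  obtain ⟨f, ts, i⟩ := h
  have h₁ := lt_succ_encode_of_mem (List.ofFn fun i => code (ts i)) (code (ts i))
    ((List.mem_ofFn' _ _).2 ⟨i, rfl⟩)
  have h₂ := Nat.right_le_pair f (encode (List.ofFn fun i => code (ts i)))
  simp only [code]
  omega

theorem le_code_of_mem_vars {x : ℕ} : ∀ {t : Term}, x ∈ t.vars → x ≤ code t
  | var y, h => by
    rw [mem_vars_var] at h
    simp only [code]
    omega
  | app f ts, h => by
    obtain ⟨i, hi⟩ := mem_vars_app.1 h
    exact (le_code_of_mem_vars hi).trans (code_lt_of_child (.mk f ts i)).le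

end Term

section Primrec

variable {α β σ : Type*} [Primcodable α] [Primcodable β] [Primcodable σ]

theorem primrec_var : Primrec Term.var := by
  rw [← Primrec.encode_iff]
  exact Primrec.nat_double

theorem primrec_mkApp : Primrec₂ Term.mkApp := by
  have : Primrec fun p : ℕ × List Term => 2 * Nat.pair p.1 (encode p.2) + 1 :=
    Primrec.nat_double_succ.comp (Primrec₂.natPair.comp .fst (Primrec.encode.comp .snd))
  refine Primrec.encode_iff.1 (this.of_eq fun p => ?_)
  exact (code_mkApp p.1 p.2).symm

theorem primrec_dest : Primrec Term.dest := by
  have h₁ : Primrec fun t : Term => encode t % 2 :=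
    Primrec.nat_mod.comp Primrec.encode (.const 2)
  have h₂ : Primrec fun t : Term => encode t / 2 :=
    Primrec.nat_div.comp Primrec.encode (.const 2)
  have h₃ : Primrec fun t : Term => (encode t / 2).unpair := Primrec.unpair.comp h₂
  have : Primrec fun t : Term => if encode t % 2 = 0 then
      (Sum.inl (encode t / 2) : ℕ ⊕ (ℕ × List Term))
      else .inr ((encode t / 2).unpair.1, Denumerable.ofNat (List Term) (encode t / 2).unpair.2) :=
    Primrec.ite (Primrec.eq.comp h₁ (.const 0)) (Primrec.sumInl.comp h₂)
      (Primrec.sumInr.comp ((Primrec.fst.comp h₃).pair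
        ((Primrec.ofNat _).comp (Primrec.snd.comp h₃))))
  refine this.of_eq fun t => ?_
  cases t with
  | var x =>
    have : encode (var x) = 2 * x := rfl
    rw [this, if_pos (by omega), dest]
    congr 1
    omega
  | app f ts =>
    have : encode (app f ts) = 2 * Nat.pair f (encode (List.ofFn ts)) + 1 := code_app f ts
    have h' : (2 * Nat.pair f (encode (List.ofFn ts)) + 1) / 2
        = Nat.pair f (encode (List.ofFn ts)) := by omega
    rw [this, if_neg (by omega), dest, h', Nat.unpair_pair]
    simp

/-- Functions defined by structural recursion on terms are primitive recursive. -/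
theorem primrec_termRec {F : α → Term → σ} {g : α → ℕ → σ}
    {h : α → ℕ × List (Term × σ) → σ} (hg : Primrec₂ g) (hh : Primrec₂ h)
    (hvar : ∀ a x, F a (var x) = g a x)
    (happ : ∀ a (n f : ℕ) (ts : Fin n → Term),
      F a (app f ts) = h a (f, List.ofFn fun i => (ts i, F a (ts i)))) : Primrec₂ F := by
  -- Course-of-values recursion on codes: arguments have smaller codes, so their values are already
  -- stored in `prev`.
  have key : Primrec₂ fun (a : α) (n : ℕ) => F a (Denumerable.ofNat Term n) := by
    have hd : Primrec fun p : α × List σ => dest (Denumerable.ofNat Term p.2.length) :=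
      primrec_dest.comp ((Primrec.ofNat Term).comp (Primrec.list_length.comp .snd))
    have hlook : Primrec₂ fun (p : (α × List σ) × (ℕ × List Term)) (t : Term) =>
        (p.1.2[encode t]?).map fun s => (t, s) :=
      Primrec.option_map (Primrec.list_getElem?.comp
        (Primrec.snd.comp (Primrec.fst.comp .fst)) (Primrec.encode.comp .snd))
        (Primrec₂.pair.comp (Primrec.snd.comp .fst) .snd)
    refine Primrec.nat_strong_rec _ (g := fun a prev =>
      some (Sum.casesOn (dest (Denumerable.ofNat Term prev.length)) (fun x => g a x)
        fun q => h a (q.1, q.2.filterMap fun t => (prev[encode t]?).map fun s => (t, s)))) ?_ ?_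
    · refine Primrec.option_some.comp (Primrec.sumCasesOn hd ?_ ?_)
      · exact hg.comp (Primrec.fst.comp .fst) .snd
      · exact hh.comp (Primrec.fst.comp .fst)
          ((Primrec.fst.comp .snd).pair (Primrec.listFilterMap (Primrec.snd.comp .snd) hlook))
    · intro a n
      simp only [List.length_map, List.length_range]
      have hn : encode (Denumerable.ofNat Term n) = n := Denumerable.encode_ofNat n
      cases ht : Denumerable.ofNat Term n with
      | var x => simp [dest, hvar]
      | @app m f ts =>
        simp only [dest, happ]
        congr 3
        have hlt : ∀ i, encode (ts i) < n := by
          intro i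
          rw [← hn, ht]
          exact code_lt_of_child (.mk f ts i)
        have : ∀ t ∈ List.ofFn ts, (((List.range n).map fun k =>
            F a (Denumerable.ofNat Term k))[encode t]?).map (fun s => (t, s))
            = some (t, F a t) := by
          intro t hmem
          obtain ⟨i, rfl⟩ := (List.mem_ofFn' _ _).1 hmem
          simp [hlt i]
        rw [List.filterMap_congr this, List.filterMap_eq_map', List.map_ofFn]
        rfl
  refine (key.comp₂ Primrec₂.left (Primrec.encode.comp₂ Primrec₂.right)).of_eq fun a t => ?_
  simp

theorem primrec_all {f : α → List β} {p : α → β → Bool} (hf : Primrec f) (hp : Primrec₂ p) :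
    Primrec fun a => (f a).all (p a) := by
  have : Primrec fun a => (f a).foldr (fun b s => p a b && s) true :=
    Primrec.list_foldr hf (.const true)
      (Primrec.and.comp (hp.comp .fst (Primrec.fst.comp .snd)) (Primrec.snd.comp .snd)).to₂
  refine this.of_eq fun a => ?_
  induction f a with
  | nil => rfl
  | cons b l ih => rw [List.foldr_cons, ih, List.all_cons]

theorem primrec_any {f : α → List β} {p : α → β → Bool} (hf : Primrec f) (hp : Primrec₂ p) :
    Primrec fun a => (f a).any (p a) := by
  have : Primrec fun a => !(f a).all fun b => !p a b :=
    Primrec.not.comp (primrec_all hf (Primrec.not.comp hp).to₂)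
  refine this.of_eq fun a => ?_
  rw [Bool.eq_iff_iff]
  simp

theorem primrec_filter {f : α → List β} {p : α → β → Bool} (hf : Primrec f) (hp : Primrec₂ p) :
    Primrec fun a => (f a).filter (p a) := by
  have : Primrec fun a => (f a).filterMap fun b => bif p a b then some b else none :=
    Primrec.listFilterMap hf
      (Primrec.cond hp (Primrec.option_some.comp .snd) (.const none)).to₂
  refine this.of_eq fun a => ?_
  induction f a with
  | nil => rfl
  | cons b l ih => by_cases hb : p a b <;> simp [hb, ih]

theorem primrec_isEmpty {f : α → List β} (hf : Primrec f) : Primrec fun a => (f a).isEmpty := by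
  have : Primrec fun a => (f a).all fun _ => false := primrec_all hf (Primrec₂.const false)
  refine this.of_eq fun a => ?_
  cases f a <;> rfl

/-- Equality test through encodings. -/
def beqCode (a b : β) : Bool := decide (encode a = encode b)

@[simp] theorem beqCode_iff {a b : β} : beqCode a b = true ↔ a = b := by
  simp [beqCode]

theorem primrec_beqCode {f g : α → β} (hf : Primrec f) (hg : Primrec g) :
    Primrec fun a => beqCode (f a) (g a) :=
  Primrec.eq.decide.comp (Primrec.encode.comp hf) (Primrec.encode.comp hg)

/-- Membership test through encodings. -/
def memCode (b : β) (l : List β) : Bool := l.any fun c => beqCode c b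

@[simp] theorem memCode_iff {b : β} {l : List β} : memCode b l = true ↔ b ∈ l := by
  simp [memCode]

theorem primrec_memCode {f : α → β} {g : α → List β} (hf : Primrec f) (hg : Primrec g) :
    Primrec fun a => memCode (f a) (g a) :=
  primrec_any hg (primrec_beqCode .snd (hf.comp .fst)).to₂

/-- A predicate with primitive recursively checkable certificates is recursively enumerable. -/
theorem rePred_exists {p : α → β → Bool} (hp : Primrec₂ p) : REPred fun a => ∃ b, p a b = true := by
  have hc : Primrec₂ fun (a : α) (n : ℕ) => ((decode n : Option β).map (p a)).getD false :=
    Primrec.option_getD.comp (Primrec.option_map (Primrec.decode.comp .snd)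
      (hp.comp (Primrec.fst.comp .fst) .snd)) (.const false)
  have := Partrec.dom_re (Partrec.rfind (Computable₂.partrec₂ hc.to_comp))
  refine this.of_eq fun a => ?_
  rw [Nat.rfind_dom]
  constructor
  · rintro ⟨n, hn, -⟩
    cases hd : (decode n : Option β) with
    | none => simp [hd] at hn
    | some b => exact ⟨b, by simpa [hd] using hn⟩
  · rintro ⟨b, hb⟩
    exact ⟨encode b, by simp [hb], fun _ => trivial⟩

end Primrec

/-! ### Subterms, variables, symbols and steps as lists -/

/-- Instantiation of variables by the entries of a list. -/
def substList (l : List Term) (t : Term) : Term := t.subst fun x => l.getD x (var x)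

/-- The list of subterms. -/
def subterms : Term → List Term
  | var x => [var x]
  | app f ts => app f ts :: (List.ofFn fun i => subterms (ts i)).flatten

/-- The list of occurrences of variables. -/
def varList : Term → List ℕ
  | var x => [x]
  | app _ ts => (List.ofFn fun i => varList (ts i)).flatten

/-- The list of occurrences of function symbols. -/
def symList : Term → List (ℕ × ℕ)
  | var _ => []
  | @app n f ts => (n, f) :: (List.ofFn fun i => symList (ts i)).flatten

/-- The lists of length `k` with entries from `L`. -/
def tuples (k : ℕ) (L : List Term) : List (List Term) :=
  k.rec [[]] fun _ acc => acc.flatMap fun l => L.map fun t => t :: l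

/-- The results of root steps whose redex has allowed arguments only. -/
noncomputable def rootSteps (R : List Rule) (al : Term → Bool) (t : Term) : List Term :=
  bif t.args.all al then
    R.flatMap fun ρ => ((tuples (encode ρ.1 + 1) (subterms t)).filter fun l =>
      beqCode (substList l ρ.1) t).map fun l => substList l ρ.2
  else []

/-- All ways of replacing one first component by an element of the corresponding list. -/
def replaceOne : List (Term × List Term) → List (List Term)
  | [] => []
  | p :: l => (p.2.map fun t => t :: l.map Prod.fst) ++ (replaceOne l).map fun l' => p.1 :: l'

/-- The results of steps whose redex has allowed arguments only. -/
noncomputable def steps (R : List Rule) (al : Term → Bool) : Term → List Term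
  | var x => rootSteps R al (var x)
  | app f ts => rootSteps R al (app f ts) ++
      (replaceOne (List.ofFn fun i => (ts i, steps R al (ts i)))).map (mkApp f)

theorem mem_subterms {s : Term} : ∀ {t : Term}, s ∈ subterms t ↔ ReflTransGen Child t s
  | var x => by
    simp only [subterms, List.mem_singleton]
    constructor
    · rintro rfl
      exact .refl
    · intro h
      rcases ReflTransGen.cases_head h with h | ⟨c, h, -⟩
      · exact h.symm
      · exact absurd h not_child_var
  | app f ts => by
    simp only [subterms, List.mem_cons, List.mem_flatten, List.mem_ofFn, exists_exists_eq_and]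
    constructor
    · rintro (rfl | ⟨i, hi⟩)
      · exact .refl
      · exact .head (.mk f ts i) (mem_subterms.1 hi)
    · intro h
      rcases ReflTransGen.cases_head h with h | ⟨c, h, hc⟩
      · exact .inl h.symm
      · obtain ⟨i, rfl⟩ := child_app.1 h
        exact .inr ⟨i, mem_subterms.2 hc⟩

theorem mem_varList {x : ℕ} : ∀ {t : Term}, x ∈ varList t ↔ x ∈ t.vars
  | var y => by simp [varList, mem_vars_var]
  | app f ts => by
    simp only [varList, List.mem_flatten, List.mem_ofFn, exists_exists_eq_and, mem_vars_app]
    exact exists_congr fun i => mem_varList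

theorem varList_isEmpty {t : Term} : (varList t).isEmpty = true ↔ t.vars = ∅ := by
  rw [List.isEmpty_iff, List.eq_nil_iff_forall_not_mem, Set.eq_empty_iff_forall_notMem]
  simp only [mem_varList]

theorem symList_subset {S : List (ℕ × ℕ)} : ∀ {t : Term},
    (∀ p ∈ symList t, p ∈ S) ↔ t.Over S
  | var x => by simp [symList, Over]
  | app f ts => by
    rw [over_app]
    simp only [← symList_subset (t := ts _), symList, List.mem_cons, List.mem_flatten,
      List.mem_ofFn, exists_exists_eq_and]
    constructor
    · exact fun h => ⟨h _ (.inl rfl), fun i p hp => h p (.inr ⟨i, hp⟩)⟩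
    · rintro ⟨h₁, h₂⟩ p (rfl | ⟨i, hi⟩)
      · exact h₁
      · exact h₂ i p hi

theorem mem_tuples {L : List Term} : ∀ {k : ℕ} {l : List Term},
    l ∈ tuples k L ↔ l.length = k ∧ ∀ t ∈ l, t ∈ L
  | 0, l => by
    have : tuples 0 L = [[]] := rfl
    simp only [this, List.mem_singleton, List.length_eq_zero_iff]
    constructor
    · rintro rfl
      simp
    · exact And.left
  | k + 1, l => by
    have : tuples (k + 1) L = (tuples k L).flatMap fun l => L.map fun t => t :: l := rfl
    simp only [this, List.mem_flatMap, List.mem_map, mem_tuples (k := k)]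
    constructor
    · rintro ⟨l, ⟨h₁, h₂⟩, t, ht, rfl⟩
      exact ⟨by simp [h₁], by simpa using ⟨ht, h₂⟩⟩
    · rintro ⟨h₁, h₂⟩
      cases l with
      | nil => simp at h₁
      | cons t l =>
        simp only [List.length_cons, Nat.add_right_cancel_iff] at h₁
        exact ⟨l, ⟨h₁, fun u hu => h₂ u (List.mem_cons_of_mem _ hu)⟩, t,
          h₂ t List.mem_cons_self, rfl⟩

/-- Matching by exhaustive search. The variables of the left-hand side are bounded by its code, and
in a match their values are subterms of the redex, so finitely many lists of values suffice. -/
theorem mem_rootSteps {R : List Rule} (hR : ∀ ρ ∈ R, ρ.2.vars ⊆ ρ.1.vars) {al : Term → Bool}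
    {s t : Term} : t ∈ rootSteps R al s ↔ RootStep (fun w => al w = true) R s t := by
  by_cases hal : s.args.all al = true
  · simp only [rootSteps, hal, cond_true, List.mem_flatMap, List.mem_map, List.mem_filter,
      beqCode_iff, mem_tuples]
    rw [List.all_eq_true] at hal
    simp only [mem_args] at hal
    constructor
    · rintro ⟨ρ, hρ, l, ⟨-, hl⟩, rfl⟩
      exact ⟨ρ, hρ, _, hl.symm, rfl, hal⟩
    · rintro ⟨ρ, hρ, σ, h₁, rfl, -⟩
      clear hal
      classical
      -- Entries for numbers that are not variables of the left-hand side are irrelevant. They are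
      -- set to `s`, so that all entries are subterms of `s`.
      have hget : ∀ x ∈ ρ.1.vars, ((List.range (encode ρ.1 + 1)).map fun x =>
          if x ∈ ρ.1.vars then σ x else s).getD x (var x) = σ x := by
        intro x hx
        have : x < encode ρ.1 + 1 := Nat.lt_succ_of_le (le_code_of_mem_vars hx)
        simp [this, hx]
      refine ⟨ρ, hρ, (List.range (encode ρ.1 + 1)).map fun x =>
        if x ∈ ρ.1.vars then σ x else s, ⟨⟨by simp, fun u hu => ?_⟩, ?_⟩, ?_⟩
      · obtain ⟨x, -, rfl⟩ := List.mem_map.1 hu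
        rw [mem_subterms]
        by_cases hx : x ∈ ρ.1.vars
        · rw [if_pos hx, h₁]
          exact sub_subst hx
        · rw [if_neg hx]
      · exact (subst_congr hget).trans h₁.symm
      · exact subst_congr fun x hx => hget x (hR ρ hρ hx)
  · simp only [rootSteps, hal, cond_false, List.not_mem_nil, false_iff]
    rintro ⟨ρ, hρ, σ, -, -, h⟩
    exact hal (List.all_eq_true.2 fun w hw => h w (mem_args.1 hw))

theorem mem_replaceOne : ∀ {l : List (Term × List Term)} {l' : List Term},
    l' ∈ replaceOne l ↔ ∃ i, ∃ h : i < l.length, ∃ t ∈ l[i].2, l' = (l.map Prod.fst).set i t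
  | [], l' => by simp [replaceOne]
  | p :: l, l' => by
    simp only [replaceOne, List.mem_append, List.mem_map, mem_replaceOne (l := l)]
    constructor
    · rintro (⟨t, ht, rfl⟩ | ⟨l'', ⟨i, hi, t, ht, rfl⟩, rfl⟩)
      · exact ⟨0, by simp, t, by simpa using ht, by simp⟩
      · exact ⟨i + 1, by simpa using hi, t, by simpa using ht, by simp⟩
    · rintro ⟨i, hi, t, ht, rfl⟩
      cases i with
      | zero => exact .inl ⟨t, by simpa using ht, by simp⟩
      | succ i =>
        exact .inr ⟨_, ⟨i, by simpa using hi, t, by simpa using ht, rfl⟩, by simp⟩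

theorem ofFn_update {n : ℕ} (ts : Fin n → Term) (i : Fin n) (t : Term) :
    List.ofFn (Function.update ts i t) = (List.ofFn ts).set i t := by
  refine List.ext_getElem (by simp) fun j h₁ h₂ => ?_
  simp only [List.getElem_ofFn, List.getElem_set, Function.update_apply, Fin.ext_iff]
  by_cases h : j = i
  · simp [h]
  · have : ¬ (i : ℕ) = j := fun h' => h h'.symm
    simp [h, this]

theorem mem_steps {R : List Rule} (hR : ∀ ρ ∈ R, ρ.2.vars ⊆ ρ.1.vars) {al : Term → Bool} :
    ∀ {s t : Term}, t ∈ steps R al s ↔ RStep (fun w => al w = true) R s t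
  | var x, t => by
    rw [steps, mem_rootSteps hR]
    constructor
    · exact .root
    · intro h
      cases h with
      | root h => exact h
  | @app n f ts, t => by
    rw [steps, List.mem_append, mem_rootSteps hR]
    simp only [List.mem_map, mem_replaceOne, List.length_ofFn, List.getElem_ofFn, List.map_ofFn]
    constructor
    · rintro (h | ⟨l, ⟨i, hi, t, ht, rfl⟩, rfl⟩)
      · exact .root h
      · have := CtxStep.arg f ts ⟨i, hi⟩ ((mem_steps hR).1 ht)
        rw [← mkApp_ofFn f (Function.update _ _ _), ofFn_update] at this
        exact this
    · intro h
      cases h with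
      | root h => exact .inl h
      | @arg _ _ _ i t h =>
        refine .inr ⟨_, ⟨i, i.2, t, (mem_steps hR).2 h, rfl⟩, ?_⟩
        rw [← mkApp_ofFn, ofFn_update]
        rfl

section Primrec

variable {α : Type*} [Primcodable α]

theorem primrec_args : Primrec Term.args := by
  have : Primrec fun t => (Sum.casesOn (dest t) (fun _ => []) fun q => q.2 : List Term) :=
    Primrec.sumCasesOn primrec_dest (Primrec₂.const []) (Primrec.snd.comp .snd).to₂
  refine this.of_eq fun t => ?_
  cases t <;> rfl

theorem primrec_substList : Primrec₂ substList := by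
  refine primrec_termRec (g := fun l x => l.getD x (var x))
    (h := fun _ q => mkApp q.1 (q.2.map Prod.snd)) ?_ ?_ ?_ ?_
  · have : Primrec fun p : List Term × ℕ => (p.1[p.2]?).getD (var p.2) :=
      Primrec.option_getD.comp (Primrec.list_getElem?.comp .fst .snd) (primrec_var.comp .snd)
    refine this.of_eq fun p => ?_
    simp
  · exact primrec_mkApp.comp (Primrec.fst.comp .snd)
      (Primrec.list_map (Primrec.snd.comp .snd) (Primrec.snd.comp .snd).to₂)
  · intro l x
    rfl
  · intro l n f ts
    rw [List.map_ofFn, mkApp_ofFn]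
    rfl

theorem primrec_subterms : Primrec subterms := by
  have : Primrec₂ fun (_ : Unit) (t : Term) => subterms t := by
    refine primrec_termRec (g := fun _ x => [var x])
      (h := fun _ q => mkApp q.1 (q.2.map Prod.fst) :: (q.2.map Prod.snd).flatten) ?_ ?_ ?_ ?_
    · exact Primrec.list_cons.comp (primrec_var.comp .snd) (.const [])
    · exact Primrec.list_cons.comp
        (primrec_mkApp.comp (Primrec.fst.comp .snd)
          (Primrec.list_map (Primrec.snd.comp .snd) (Primrec.fst.comp .snd).to₂))
        (Primrec.list_flatten.comp
          (Primrec.list_map (Primrec.snd.comp .snd) (Primrec.snd.comp .snd).to₂))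
    · intro _ x
      rfl
    · intro _ n f ts
      rw [List.map_ofFn, List.map_ofFn]
      exact congrArg (· :: _) (mkApp_ofFn f ts).symm
  exact this.comp (.const ()) .id

theorem primrec_varList : Primrec varList := by
  have : Primrec₂ fun (_ : Unit) (t : Term) => varList t := by
    refine primrec_termRec (g := fun _ x => [x])
      (h := fun _ q => (q.2.map Prod.snd).flatten) ?_ ?_ ?_ ?_
    · exact Primrec.list_cons.comp .snd (.const [])
    · exact Primrec.list_flatten.comp
        (Primrec.list_map (Primrec.snd.comp .snd) (Primrec.snd.comp .snd).to₂)
    · intro _ x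
      rfl
    · intro _ n f ts
      rw [List.map_ofFn]
      rfl
  exact this.comp (.const ()) .id

theorem primrec_symList : Primrec symList := by
  have : Primrec₂ fun (_ : Unit) (t : Term) => symList t := by
    refine primrec_termRec (g := fun _ x => [])
      (h := fun _ q => (q.2.length, q.1) :: (q.2.map Prod.snd).flatten) ?_ ?_ ?_ ?_
    · exact .const []
    · exact Primrec.list_cons.comp
        ((Primrec.list_length.comp (Primrec.snd.comp .snd)).pair (Primrec.fst.comp .snd))
        (Primrec.list_flatten.comp
          (Primrec.list_map (Primrec.snd.comp .snd) (Primrec.snd.comp .snd).to₂))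
    · intro _ x
      rfl
    · intro _ n f ts
      rw [List.map_ofFn, List.length_ofFn]
      rfl
  exact this.comp (.const ()) .id

theorem primrec_tuples : Primrec₂ tuples := by
  refine Primrec.nat_rec' (f := fun p : ℕ × List Term => p.1) (g := fun _ => [[]])
    (h := fun p q => q.2.flatMap fun l => p.2.map fun t => t :: l) .fst (.const _) ?_
  refine Primrec.list_flatMap (Primrec.snd.comp .snd) ?_
  exact Primrec.list_map (Primrec.snd.comp (Primrec.fst.comp .fst))
    (Primrec.list_cons.comp .snd (Primrec.snd.comp .fst)).to₂

theorem primrec_replaceOne : Primrec replaceOne := by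
  have : Primrec fun l : List (Term × List Term) => (l.rec [] fun p l acc =>
      (p.2.map fun t => t :: l.map Prod.fst) ++ acc.map fun l' => p.1 :: l' : List (List Term)) := by
    refine Primrec.list_rec (f := fun l : List (Term × List Term) => l) (g := fun _ => [])
      (h := fun _ q => (q.1.2.map fun t => t :: q.2.1.map Prod.fst) ++
        q.2.2.map fun l' => q.1.1 :: l') .id (.const []) ?_
    refine Primrec.list_append.comp ?_ ?_
    · exact Primrec.list_map (Primrec.snd.comp (Primrec.fst.comp .snd))
        (Primrec.list_cons.comp .snd (Primrec.list_map
          (Primrec.fst.comp (Primrec.snd.comp (Primrec.snd.comp .fst)))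
          (Primrec.fst.comp .snd).to₂)).to₂
    · exact Primrec.list_map (Primrec.snd.comp (Primrec.snd.comp .snd))
        (Primrec.list_cons.comp (Primrec.fst.comp (Primrec.fst.comp (Primrec.snd.comp .fst)))
          .snd).to₂
  refine this.of_eq fun l => ?_
  induction l with
  | nil => rfl
  | cons p l ih => rw [replaceOne, ← ih]

theorem primrec_rootSteps {R : α → List Rule} {al : α → Term → Bool} (hR : Primrec R)
    (hal : Primrec₂ al) : Primrec₂ fun a t => rootSteps (R a) (al a) t := by
  refine Primrec.cond (primrec_all (primrec_args.comp .snd)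
    (hal.comp (Primrec.fst.comp .fst) .snd).to₂) ?_ (.const [])
  refine Primrec.list_flatMap (hR.comp .fst) ?_
  refine Primrec.list_map (primrec_filter (primrec_tuples.comp
    (Primrec.succ.comp (Primrec.encode.comp (Primrec.fst.comp .snd)))
    (primrec_subterms.comp (Primrec.snd.comp .fst)))
    (primrec_beqCode (primrec_substList.comp .snd (Primrec.fst.comp (Primrec.snd.comp .fst)))
      (Primrec.snd.comp (Primrec.fst.comp .fst))).to₂) ?_
  exact (primrec_substList.comp .snd (Primrec.snd.comp (Primrec.snd.comp .fst))).to₂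

theorem primrec_steps {R : α → List Rule} {al : α → Term → Bool} (hR : Primrec R)
    (hal : Primrec₂ al) : Primrec₂ fun a t => steps (R a) (al a) t := by
  have hroot := primrec_rootSteps hR hal
  refine primrec_termRec (g := fun a x => rootSteps (R a) (al a) (var x))
    (h := fun a q => rootSteps (R a) (al a) (mkApp q.1 (q.2.map Prod.fst)) ++
      (replaceOne q.2).map (mkApp q.1)) ?_ ?_ ?_ ?_
  · exact hroot.comp .fst (primrec_var.comp .snd)
  · refine Primrec.list_append.comp (hroot.comp .fst (primrec_mkApp.comp (Primrec.fst.comp .snd)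
      (Primrec.list_map (Primrec.snd.comp .snd) (Primrec.fst.comp .snd).to₂))) ?_
    exact Primrec.list_map (primrec_replaceOne.comp (Primrec.snd.comp .snd))
      (primrec_mkApp.comp (Primrec.fst.comp (Primrec.snd.comp .fst)) .snd).to₂
  · intro a x
    rfl
  · intro a n f ts
    simp only [List.map_ofFn]
    rw [steps]
    congr 2
    exact (mkApp_ofFn f ts).symm

theorem primrec_height : Primrec Term.height := by
  have : Primrec₂ fun (_ : Unit) (t : Term) => t.height := by
    refine primrec_termRec (g := fun _ _ => 0)
      (h := fun _ q => q.2.foldr (fun p m => max (p.2 + 1) m) 0) ?_ ?_ ?_ ?_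
    · exact .const 0
    · exact Primrec.list_foldr (Primrec.snd.comp .snd) (.const 0)
        (Primrec.nat_max.comp (Primrec.succ.comp (Primrec.snd.comp (Primrec.fst.comp .snd)))
          (Primrec.snd.comp .snd)).to₂
    · intro _ x
      rfl
    · intro _ n f ts
      have : ∀ n (φ : Fin n → Term × ℕ), (List.ofFn φ).foldr (fun p m => max (p.2 + 1) m) 0
          = Finset.univ.sup fun i => (φ i).2 + 1 := by
        intro n
        induction n with
        | zero => intro φ; simp
        | succ n ih =>
          intro φ
          rw [List.ofFn_succ, List.foldr_cons, ih, Fin.univ_succ, Finset.sup_cons,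
            Finset.sup_map]
          rfl
      rw [this]
      rfl
  exact this.comp (.const ()) .id

end Primrec

end RewritingModulo
-- Primitive recursive tests for the hypotheses and for certificates.
namespace RewritingModulo

open Relation Term Encodable

/-! ### Deciding the hypotheses -/

/-- Test for being a variable. -/
def isVar (t : Term) : Bool := Sum.casesOn (dest t) (fun _ => true) fun _ => false

theorem isVar_iff {t : Term} : isVar t = true ↔ ∃ x, t = var x := by
  cases t <;> simp [isVar, dest]

/-- Test for the absence of repeated variables in a list. -/
noncomputable def distinctCheck (L : List Term) : Bool :=
  (List.range L.length).all fun i => (List.range L.length).all fun j =>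
    -- The default `mkApp 0 []` is never used, because both indices are in range.
    decide (i = j) || (!isVar (L.getD i (mkApp 0 [])) ||
      !beqCode (L.getD i (mkApp 0 [])) (L.getD j (mkApp 0 [])))

/-- Test for the conditions of `GoodRule`. -/
noncomputable def goodCheck (S : List (ℕ × ℕ)) (ρ : Rule) : Bool :=
  (symList ρ.1).all (fun p => memCode p S) &&
  ((symList ρ.2).all (fun p => memCode p S) &&
  (!isVar ρ.1 &&
  ((varList ρ.2).all (fun x => memCode x (varList ρ.1)) &&
  (ρ.2.args.all (fun w => isVar w || (varList w).isEmpty) &&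
  distinctCheck ρ.2.args))))

theorem goodCheck_iff {S : List (ℕ × ℕ)} {ρ : Rule} :
    goodCheck S ρ = true ↔ GoodRule S ρ := by
  simp only [goodCheck, distinctCheck, Bool.and_eq_true, List.all_eq_true, memCode_iff, symList_subset,
    Bool.or_eq_true, Bool.not_eq_true', isVar_iff, varList_isEmpty, mem_varList,
    decide_eq_true_eq, List.mem_range, mem_args, ← Bool.not_eq_true, beqCode_iff]
  constructor
  · rintro ⟨h₁, h₂, h₃, h₄, h₅, h₆⟩
    refine ⟨⟨h₁, h₂, fun x hx => h₃ ⟨x, hx⟩, h₄⟩, ?_, ?_⟩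
    · rintro n g rs hr j
      exact h₅ _ (hr ▸ .mk g rs j)
    · rintro n g rs hr i j x hi hj
      rw [hr] at h₆
      have := h₆ i (by simp [args]) j (by simp [args])
      simp only [args, List.getD_eq_getElem?_getD, List.getElem?_ofFn, Fin.is_lt, dite_true,
        Fin.eta, Option.getD_some, hi, hj, not_true_eq_false, or_false] at this
      rcases this with h | h
      · exact Fin.ext h
      · exact absurd ⟨x, rfl⟩ h
  · rintro ⟨⟨h₁, h₂, h₃, h₄⟩, h₅, h₆⟩
    refine ⟨h₁, h₂, fun ⟨x, hx⟩ => h₃ x hx, h₄, ?_, ?_⟩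
    · intro w hw
      cases hr : ρ.2 with
      | var x => rw [hr] at hw; exact absurd hw not_child_var
      | app g rs =>
        rw [hr] at hw
        obtain ⟨j, rfl⟩ := child_app.1 hw
        exact h₅ _ g rs hr j
    · intro i hi j hj
      cases hr : ρ.2 with
      | var x => simp [hr, args] at hi
      | @app n g rs =>
        simp only [hr, args, List.length_ofFn] at hi hj
        simp only [args, List.getD_eq_getElem?_getD, List.getElem?_ofFn, hi, hj, dite_true,
          Option.getD_some]
        by_contra hcon
        push Not at hcon
        obtain ⟨hne, ⟨x, hx⟩, hij⟩ := hcon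
        exact hne (congrArg Fin.val (h₆ n g rs hr ⟨i, hi⟩ ⟨j, hj⟩ x hx (hij ▸ hx)))

/-- A signature with two lists of rules. -/
abbrev Input : Type := List (ℕ × ℕ) × List Rule × List Rule

/-- Test for the conditions of `System`. -/
noncomputable def sysCheck (a : Input) : Bool :=
  (a.2.1 ++ a.2.2).all (goodCheck a.1) &&
  a.2.2.all fun ρ => decide (ρ.1.height ≤ 1) &&
    (decide (ρ.1.height = ρ.2.height) && memCode (ρ.2, ρ.1) a.2.2)

theorem sysCheck_iff {S : List (ℕ × ℕ)} {R E : List Rule} :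
    sysCheck (S, R, E) = true ↔ System S R E := by
  simp only [sysCheck, Bool.and_eq_true, List.all_eq_true, goodCheck_iff, decide_eq_true_eq,
    memCode_iff]
  exact ⟨fun h => ⟨h.1, fun ρ hρ => (h.2 ρ hρ).1, fun ρ hρ => (h.2 ρ hρ).2.1,
    fun ρ hρ => (h.2 ρ hρ).2.2⟩,
    fun h => ⟨h.good, fun ρ hρ => ⟨h.flat ρ hρ, h.height ρ hρ, h.symm ρ hρ⟩⟩⟩

theorem primrec_isVar : Primrec isVar :=
  Primrec.sumCasesOn primrec_dest (Primrec₂.const true) (Primrec₂.const false)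

theorem primrec_distinctCheck : Primrec distinctCheck := by
  have hlen : Primrec fun L : List Term => List.range L.length :=
    Primrec.list_range.comp Primrec.list_length
  have hget : Primrec₂ fun (L : List Term) (i : ℕ) => L.getD i (mkApp 0 []) :=
    Primrec.list_getD _
  have hi : Primrec fun q : (List Term × ℕ) × ℕ => q.1.1.getD q.1.2 (mkApp 0 []) :=
    hget.comp (Primrec.fst.comp .fst) (Primrec.snd.comp .fst)
  have hj : Primrec fun q : (List Term × ℕ) × ℕ => q.1.1.getD q.2 (mkApp 0 []) :=
    hget.comp (Primrec.fst.comp .fst) .snd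
  have hij : Primrec₂ fun (q : List Term × ℕ) (j : ℕ) => decide (q.2 = j) ||
      (!isVar (q.1.getD q.2 (mkApp 0 [])) ||
        !beqCode (q.1.getD q.2 (mkApp 0 [])) (q.1.getD j (mkApp 0 []))) :=
    Primrec.or.comp (Primrec.eq.decide.comp (Primrec.snd.comp .fst) .snd)
      (Primrec.or.comp (Primrec.not.comp (primrec_isVar.comp hi))
        (Primrec.not.comp (primrec_beqCode hi hj)))
  exact primrec_all hlen (primrec_all (hlen.comp .fst) hij)

theorem primrec_goodCheck : Primrec₂ goodCheck := by
  have hl : Primrec fun p : List (ℕ × ℕ) × Rule => p.2.1 := Primrec.fst.comp .snd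
  have hr : Primrec fun p : List (ℕ × ℕ) × Rule => p.2.2 := Primrec.snd.comp .snd
  refine Primrec.and.comp (primrec_all (primrec_symList.comp hl)
    (primrec_memCode .snd (Primrec.fst.comp .fst)).to₂) ?_
  refine Primrec.and.comp (primrec_all (primrec_symList.comp hr)
    (primrec_memCode .snd (Primrec.fst.comp .fst)).to₂) ?_
  refine Primrec.and.comp (Primrec.not.comp (primrec_isVar.comp hl)) ?_
  refine Primrec.and.comp (primrec_all (primrec_varList.comp hr)
    (primrec_memCode .snd (primrec_varList.comp (hl.comp .fst))).to₂) ?_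
  refine Primrec.and.comp (primrec_all (primrec_args.comp hr)
    (Primrec.or.comp (primrec_isVar.comp .snd)
      (primrec_isEmpty (primrec_varList.comp .snd))).to₂) ?_
  exact primrec_distinctCheck.comp (primrec_args.comp hr)

theorem primrec_sysCheck : Primrec sysCheck := by
  have hE : Primrec fun a : Input => a.2.2 := Primrec.snd.comp .snd
  have h₁ : Primrec fun p : Input × Rule => p.2.1.height :=
    primrec_height.comp (Primrec.fst.comp .snd)
  have h₂ : Primrec fun p : Input × Rule => p.2.2.height :=
    primrec_height.comp (Primrec.snd.comp .snd)
  refine Primrec.and.comp (primrec_all (Primrec.list_append.comp (Primrec.fst.comp .snd) hE)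
    (primrec_goodCheck.comp (Primrec.fst.comp .fst) .snd).to₂) (primrec_all hE ?_)
  exact Primrec.and.comp (Primrec.nat_le.decide.comp h₁ (.const 1))
    (Primrec.and.comp (Primrec.eq.decide.comp h₁ h₂)
      (primrec_memCode ((Primrec.snd.comp .snd).pair (Primrec.fst.comp .snd)) (hE.comp .fst)))

/-! ### Certificates -/

/-- The results of unrestricted steps. -/
noncomputable def eSteps (E : List Rule) : Term → List Term := steps E fun _ => true

/-- The results of steps and passages to arguments. -/
noncomputable def subSteps (R E : List Rule) (al : Term → Bool) (t : Term) : List Term :=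
  eSteps E t ++ (steps R al t ++ t.args)

/-- The results of `k` successive steps given by `f`. -/
def levels (f : Term → List Term) (k : ℕ) (L : List Term) : List Term :=
  (fun L => L.flatMap f)^[k] L

/-- Arguments of redexes are allowed unless they are certified to be reducible. -/
noncomputable def alPos (b : Bool) (B : List (Term × ℕ)) (w : Term) : Bool :=
  !b || !B.any fun p => beqCode p.1 w

/-- Arguments of redexes are allowed if they are certified to be normal forms. -/
noncomputable def alNeg (b : Bool) (A : List Term) (w : Term) : Bool := !b || memCode w A

/-- Test for certificates of termination: a list containing `var 0` and the variable-free subterms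
of right-hand sides and closed under steps and arguments, a list of terms with ranks closed under
steps, and a list of reducible terms. -/
noncomputable def posCheck (b : Bool) (a : Input)
    (c : List Term × List (Term × ℕ) × List (Term × ℕ)) : Bool :=
  memCode (var 0) c.1 &&
  (c.1.all (fun x => (symList x).all fun p => memCode p a.1) &&
  ((a.2.1 ++ a.2.2).all (fun ρ => (subterms ρ.2).all fun w =>
    !(varList w).isEmpty || memCode w c.1) &&
  (c.1.all (fun x => (subSteps a.2.1 a.2.2 (alPos b c.2.2) x).all fun y => memCode y c.1) &&
  (a.1.all (fun p => (tuples p.1 c.1).all fun us => c.2.1.any fun q =>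
    beqCode q.1 (mkApp p.2 us)) &&
  (c.2.1.all (fun q => (eSteps a.2.2 q.1).all fun t => c.2.1.any fun q' =>
    beqCode q'.1 t && decide (q'.2 ≤ q.2)) &&
  (c.2.1.all (fun q => (steps a.2.1 (alPos b c.2.2) q.1).all fun t => c.2.1.any fun q' =>
    beqCode q'.1 t && decide (q'.2 < q.2)) &&
  -- The number `q.2` is a count of `E`-steps after which an `R`-step applies, which shows that
  -- `q.1` is reducible modulo `E`.
  c.2.2.all fun q => (levels (eSteps a.2.2) q.2 [q.1]).any fun u =>
    !(eSteps a.2.1 u).isEmpty))))))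

/-- Test for certificates of nontermination: a term, the length of a loop from it, and a list of
normal forms. -/
noncomputable def negCheck (b : Bool) (a : Input) (c : Term × ℕ × List Term) : Bool :=
  (symList c.1).all (fun p => memCode p a.1) &&
  (c.2.2.all (fun w => (eSteps a.2.1 w).isEmpty &&
    (eSteps a.2.2 w).all fun w' => memCode w' c.2.2) &&
  (steps a.2.1 (alNeg b c.2.2) c.1).any fun v =>
    memCode c.1 (levels (subSteps a.2.1 a.2.2 (alNeg b c.2.2)) c.2.1 [v]))

section Primrec

variable {α : Type*} [Primcodable α]

theorem primrec_eSteps {E : α → List Rule} (hE : Primrec E) :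
    Primrec₂ fun a t => eSteps (E a) t :=
  primrec_steps hE (Primrec₂.const true)

theorem primrec_subSteps {R E : α → List Rule} {al : α → Term → Bool} (hR : Primrec R)
    (hE : Primrec E) (hal : Primrec₂ al) : Primrec₂ fun a t => subSteps (R a) (E a) (al a) t :=
  Primrec.list_append.comp (primrec_eSteps hE)
    (Primrec.list_append.comp (primrec_steps hR hal) (primrec_args.comp .snd))

theorem primrec_levels {f : α → Term → List Term} {k : α → ℕ} {L : α → List Term}
    (hf : Primrec₂ f) (hk : Primrec k) (hL : Primrec L) :
    Primrec fun a => levels (f a) (k a) (L a) :=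
  Primrec.nat_iterate hk hL
    (Primrec.list_flatMap .snd (hf.comp (Primrec.fst.comp .fst) .snd).to₂).to₂

theorem primrec_posCheck (b : Bool) : Primrec₂ (posCheck b) := by
  let α := Input × (List Term × List (Term × ℕ) × List (Term × ℕ))
  have hS : Primrec fun a : α => a.1.1 := Primrec.fst.comp .fst
  have hR : Primrec fun a : α => a.1.2.1 := Primrec.fst.comp (Primrec.snd.comp .fst)
  have hE : Primrec fun a : α => a.1.2.2 := Primrec.snd.comp (Primrec.snd.comp .fst)
  have hN : Primrec fun a : α => a.2.1 := Primrec.fst.comp .snd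
  have hC : Primrec fun a : α => a.2.2.1 := Primrec.fst.comp (Primrec.snd.comp .snd)
  have hB : Primrec fun a : α => a.2.2.2 := Primrec.snd.comp (Primrec.snd.comp .snd)
  have hal : Primrec₂ fun (a : α) (w : Term) => alPos b a.2.2.2 w :=
    Primrec.or.comp (.const _) (Primrec.not.comp (primrec_any (hB.comp .fst)
      (primrec_beqCode (Primrec.fst.comp .snd) (Primrec.snd.comp .fst)).to₂))
  refine Primrec.and.comp (primrec_memCode (.const _) hN) ?_
  refine Primrec.and.comp (primrec_all hN (primrec_all (primrec_symList.comp .snd)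
    (primrec_memCode .snd (hS.comp (Primrec.fst.comp .fst))).to₂).to₂) ?_
  refine Primrec.and.comp (primrec_all (Primrec.list_append.comp hR hE)
    (primrec_all (primrec_subterms.comp (Primrec.snd.comp .snd))
      (Primrec.or.comp (Primrec.not.comp (primrec_isEmpty (primrec_varList.comp .snd)))
        (primrec_memCode .snd (hN.comp (Primrec.fst.comp .fst)))).to₂).to₂) ?_
  refine Primrec.and.comp (primrec_all hN (primrec_all (primrec_subSteps hR hE hal)
    (primrec_memCode .snd (hN.comp (Primrec.fst.comp .fst))).to₂).to₂) ?_
  refine Primrec.and.comp (primrec_all hS (primrec_all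
    (primrec_tuples.comp (Primrec.fst.comp .snd) (hN.comp .fst))
    (primrec_any (hC.comp (Primrec.fst.comp .fst)) (primrec_beqCode (Primrec.fst.comp .snd)
      (primrec_mkApp.comp (Primrec.snd.comp (Primrec.snd.comp (Primrec.fst.comp .fst)))
        (Primrec.snd.comp .fst))).to₂).to₂).to₂) ?_
  refine Primrec.and.comp (primrec_all hC (primrec_all
    ((primrec_eSteps hE).comp .fst (Primrec.fst.comp .snd))
    (primrec_any (hC.comp (Primrec.fst.comp .fst)) (Primrec.and.comp
      (primrec_beqCode (Primrec.fst.comp .snd) (Primrec.snd.comp .fst))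
      (Primrec.nat_le.decide.comp (Primrec.snd.comp .snd)
        (Primrec.snd.comp (Primrec.snd.comp (Primrec.fst.comp .fst))))).to₂).to₂).to₂) ?_
  refine Primrec.and.comp (primrec_all hC (primrec_all
    ((primrec_steps hR hal).comp .fst (Primrec.fst.comp .snd))
    (primrec_any (hC.comp (Primrec.fst.comp .fst)) (Primrec.and.comp
      (primrec_beqCode (Primrec.fst.comp .snd) (Primrec.snd.comp .fst))
      (Primrec.nat_lt.decide.comp (Primrec.snd.comp .snd)
        (Primrec.snd.comp (Primrec.snd.comp (Primrec.fst.comp .fst))))).to₂).to₂).to₂) ?_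
  exact primrec_all hB (primrec_any (primrec_levels (primrec_eSteps (hE.comp .fst))
      (Primrec.snd.comp .snd) (Primrec.list_cons.comp (Primrec.fst.comp .snd) (.const [])))
    (Primrec.not.comp (primrec_isEmpty
      ((primrec_eSteps hR).comp (Primrec.fst.comp .fst) .snd))).to₂).to₂

theorem primrec_negCheck (b : Bool) : Primrec₂ (negCheck b) := by
  let α := Input × (Term × ℕ × List Term)
  have hS : Primrec fun a : α => a.1.1 := Primrec.fst.comp .fst
  have hR : Primrec fun a : α => a.1.2.1 := Primrec.fst.comp (Primrec.snd.comp .fst)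
  have hE : Primrec fun a : α => a.1.2.2 := Primrec.snd.comp (Primrec.snd.comp .fst)
  have hu : Primrec fun a : α => a.2.1 := Primrec.fst.comp .snd
  have hk : Primrec fun a : α => a.2.2.1 := Primrec.fst.comp (Primrec.snd.comp .snd)
  have hA : Primrec fun a : α => a.2.2.2 := Primrec.snd.comp (Primrec.snd.comp .snd)
  have hal : Primrec₂ fun (a : α) (w : Term) => alNeg b a.2.2.2 w :=
    Primrec.or.comp (.const _) (primrec_memCode .snd (hA.comp .fst))
  refine Primrec.and.comp (primrec_all (primrec_symList.comp hu)
    (primrec_memCode .snd (hS.comp .fst)).to₂) ?_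
  refine Primrec.and.comp (primrec_all hA (Primrec.and.comp
    (primrec_isEmpty (primrec_eSteps hR)) (primrec_all (primrec_eSteps hE)
      (primrec_memCode .snd (hA.comp (Primrec.fst.comp .fst))).to₂)).to₂) ?_
  have hlev : Primrec fun p : α × Term => levels (subSteps p.1.1.2.1 p.1.1.2.2
      (alNeg b p.1.2.2.2)) p.1.2.2.1 [p.2] :=
    primrec_levels (primrec_subSteps (hR.comp .fst) (hE.comp .fst)
      (hal.comp (Primrec.fst.comp .fst) .snd)) (hk.comp .fst)
      (Primrec.list_cons.comp .snd (.const []))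
  exact primrec_any ((primrec_steps hR hal).comp .id hu) (primrec_memCode (hu.comp .fst) hlev)

end Primrec

end RewritingModulo
-- Soundness and completeness of certificates, and decidability.
namespace RewritingModulo

open Relation Term Encodable

/-! ### Correctness of the certificates -/

section

variable {S : List (ℕ × ℕ)} {Q Q' : Term → Prop} {R E : List Rule} {b : Bool}

theorem System.vars_subset (h : System S R E) : ∀ ρ ∈ R, ρ.2.vars ⊆ ρ.1.vars :=
  fun ρ hρ => (h.goodR ρ hρ).isRewriteRule.2.2.2

theorem System.vars_subset' (h : System S R E) : ∀ ρ ∈ E, ρ.2.vars ⊆ ρ.1.vars :=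
  fun ρ hρ => (h.goodE ρ hρ).isRewriteRule.2.2.2

theorem mem_eSteps (hE : ∀ ρ ∈ E, ρ.2.vars ⊆ ρ.1.vars) {s t : Term} :
    t ∈ eSteps E s ↔ EStep E s t := by
  rw [eSteps, mem_steps hE]
  simp [EStep]

theorem mem_subSteps (h : System S R E) {al : Term → Bool} {s t : Term} :
    t ∈ subSteps R E al s ↔ SubStep (fun w => al w = true) R E s t := by
  simp [subSteps, SubStep, mem_eSteps h.vars_subset', mem_steps h.vars_subset, mem_args]

theorem mem_levels {f : Term → List Term} {r : Term → Term → Prop}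
    (hf : ∀ s t, t ∈ f s ↔ r s t) {s t : Term} :
    (∃ k, t ∈ levels f k [s]) ↔ ReflTransGen r s t := by
  constructor
  · rintro ⟨k, hk⟩
    induction k generalizing t with
    | zero =>
      simp only [levels, Function.iterate_zero, id, List.mem_singleton] at hk
      rw [hk]
    | succ k ih =>
      rw [levels, Function.iterate_succ_apply'] at hk
      obtain ⟨u, hu, htu⟩ := List.mem_flatMap.1 hk
      exact (ih hu).tail ((hf u t).1 htu)
  · intro h
    induction h with
    | refl => exact ⟨0, by simp [levels]⟩
    | tail _ h ih =>
      obtain ⟨k, hk⟩ := ih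
      refine ⟨k + 1, ?_⟩
      rw [levels, Function.iterate_succ_apply']
      exact List.mem_flatMap.2 ⟨_, hk, (hf _ _).2 h⟩

theorem not_isNormalForm_iff {w : Term} : ¬ IsNormalForm R E w ↔
    ∃ u v, ReflTransGen (EStep E) w u ∧ EStep R u v := by
  rw [IsNormalForm, not_not]
  simp only [modStep_iff, RModStep]
  constructor
  · rintro ⟨t, u, v, h₁, h₂, -⟩
    exact ⟨u, v, h₁, h₂⟩
  · rintro ⟨u, v, h₁, h₂⟩
    exact ⟨v, u, v, h₁, h₂, .refl⟩

theorem SN.mono (hQ : ∀ w, Q w → Q' w) {s : Term} (hs : SN Q' R E s) : SN Q R E s :=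
  Subrelation.accessible (r := flip (RModStep Q' R E)) (fun {_ _} hxy => by
    obtain ⟨u, v, h₁, h₂, h₃⟩ := hxy
    exact ⟨u, v, h₁, h₂.mono fun w _ => hQ w, h₃⟩) hs

theorem SubStep.mono (hQ : ∀ w, Q w → Q' w) {s t : Term} (h : SubStep Q R E s t) :
    SubStep Q' R E s t :=
  h.imp_right (Or.imp_left fun h => h.mono fun w _ => hQ w)

theorem Reach.mono (hQ : ∀ w, Q w → Q' w) {s t : Term} (h : Reach Q R E s t) :
    Reach Q' R E s t :=
  ReflTransGen.mono (fun _ _ h => SubStep.mono hQ h) _ _ h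

theorem Loops.mono (hQ : ∀ w, Q w → Q' w) : Loops S Q R E → Loops S Q' R E := by
  rintro ⟨u, v, hu, huv, hvu⟩
  exact ⟨u, v, hu, huv.mono fun w _ => hQ w, Reach.mono hQ hvu⟩

theorem posCheck_iff_forall {a : Input}
    {c : List Term × List (Term × ℕ) × List (Term × ℕ)} :
    posCheck b a c = true ↔ var 0 ∈ c.1 ∧ (∀ x ∈ c.1, x.Over a.1) ∧
      (∀ ρ ∈ a.2.1 ++ a.2.2, ∀ w, ReflTransGen Child ρ.2 w → w.vars = ∅ → w ∈ c.1) ∧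
      (∀ x ∈ c.1, ∀ y ∈ subSteps a.2.1 a.2.2 (alPos b c.2.2) x, y ∈ c.1) ∧
      (∀ p ∈ a.1, ∀ us ∈ tuples p.1 c.1, ∃ k, (mkApp p.2 us, k) ∈ c.2.1) ∧
      (∀ q ∈ c.2.1, ∀ t ∈ eSteps a.2.2 q.1, ∃ k ≤ q.2, (t, k) ∈ c.2.1) ∧
      (∀ q ∈ c.2.1, ∀ t ∈ steps a.2.1 (alPos b c.2.2) q.1, ∃ k < q.2, (t, k) ∈ c.2.1) ∧
      ∀ q ∈ c.2.2, ∃ u ∈ levels (eSteps a.2.2) q.2 [q.1], eSteps a.2.1 u ≠ [] := by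
  simp only [posCheck, Bool.and_eq_true]
  refine and_congr memCode_iff (and_congr ?_ (and_congr ?_ (and_congr ?_ (and_congr ?_
    (and_congr ?_ (and_congr ?_ ?_))))))
  · simp only [List.all_eq_true, memCode_iff, symList_subset]
  · simp only [List.all_eq_true, memCode_iff, mem_subterms, Bool.or_eq_true, Bool.not_eq_true',
      ← Bool.not_eq_true, varList_isEmpty, ← imp_iff_not_or]
  · simp only [List.all_eq_true, memCode_iff]
  · simp [List.all_eq_true, List.any_eq_true]
  · simp only [List.all_eq_true, List.any_eq_true, Bool.and_eq_true, beqCode_iff,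
      decide_eq_true_eq, Prod.exists]
    refine forall₂_congr fun q _ => forall₂_congr fun t _ => ⟨?_, ?_⟩
    · rintro ⟨_, k, h₁, rfl, h₂⟩
      exact ⟨k, h₂, h₁⟩
    · rintro ⟨k, h₂, h₁⟩
      exact ⟨t, k, h₁, rfl, h₂⟩
  · simp only [List.all_eq_true, List.any_eq_true, Bool.and_eq_true, beqCode_iff,
      decide_eq_true_eq, Prod.exists]
    refine forall₂_congr fun q _ => forall₂_congr fun t _ => ⟨?_, ?_⟩
    · rintro ⟨_, k, h₁, rfl, h₂⟩
      exact ⟨k, h₂, h₁⟩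
    · rintro ⟨k, h₂, h₁⟩
      exact ⟨t, k, h₁, rfl, h₂⟩
  · simp [List.all_eq_true, List.any_eq_true]

/-- The certificate forbids only arguments proved reducible, so the relation it checks contains the
restricted one and its strong normalization is the stronger claim. The ranks give it for function
symbols applied to elements of `N`, and `Base.sn_of_over` extends it to all terms. -/
theorem sn_of_posCheck (h : System S R E) {c : List Term × List (Term × ℕ) × List (Term × ℕ)}
    (hc : posCheck b (S, R, E) c = true) {s : Term} (hs : s.Over S) :
    SN (Restr b R E) R E s := by
  obtain ⟨N, C, B⟩ := c
  obtain ⟨h₁, h₂, h₃, h₄, h₅, h₆, h₇, h₈⟩ := posCheck_iff_forall.1 hc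
  simp only at h₁ h₂ h₃ h₄ h₅ h₆ h₇ h₈
  set Q : Term → Prop := fun w => alPos b B w = true with hQdef
  have hQ : ∀ w, Restr b R E w → Q w := by
    intro w hw
    simp only [hQdef, alPos, Bool.or_eq_true, Bool.not_eq_true', ← Bool.not_eq_true,
      List.any_eq_true, beqCode_iff, not_exists, not_and]
    by_cases hb : b = true
    · refine .inr fun p hp hpw => ?_
      obtain ⟨u, hu, hne⟩ := h₈ p hp
      obtain ⟨v, hv⟩ := List.exists_mem_of_ne_nil _ hne
      refine not_isNormalForm_iff.2 ⟨u, v, ?_, (mem_eSteps h.vars_subset).1 hv⟩ (hw hb)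
      rw [← hpw]
      exact (mem_levels fun s t => mem_eSteps h.vars_subset').1 ⟨_, hu⟩
    · exact .inl hb
  have hE : ∀ {t u}, ReflTransGen (EStep E) t u → ∀ {k}, (t, k) ∈ C →
      ∃ k' ≤ k, (u, k') ∈ C := by
    intro t u htu k hk
    induction htu with
    | refl => exact ⟨k, le_rfl, hk⟩
    | tail _ h' ih =>
      obtain ⟨k', hk', hm⟩ := ih
      obtain ⟨k'', hk'', hm'⟩ := h₆ _ hm _ ((mem_eSteps h.vars_subset').2 h')
      exact ⟨k'', hk''.trans hk', hm'⟩
  have hC : ∀ k t, (t, k) ∈ C → SN Q R E t := by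
    intro k
    induction k using Nat.strong_induction_on with
    | _ k ih =>
      intro t ht
      refine Acc.intro _ fun w ⟨u, v, k₁, k₂, k₃⟩ => ?_
      obtain ⟨i, hi, hu⟩ := hE k₁ ht
      obtain ⟨j, hj, hv⟩ := h₇ _ hu _ ((mem_steps h.vars_subset).2 k₂)
      obtain ⟨l, hl, hw⟩ := hE k₃ hv
      exact ih l (by simp only at hj; omega) w hw
  have hbase : ∀ {m g : ℕ} {us : Fin m → Term}, (m, g) ∈ S → (∀ j, us j ∈ {x | x ∈ N}) →
      SN Q R E (app g us) := by
    intro m g us hg hus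
    obtain ⟨k, hk⟩ := h₅ _ hg (List.ofFn us)
      (mem_tuples.2 ⟨by simp, fun t ht => by
        obtain ⟨i, rfl⟩ := (List.mem_ofFn' _ _).1 ht
        exact hus i⟩)
    rw [mkApp_ofFn] at hk
    exact hC k _ hk
  have hN : Base S Q R E {x | x ∈ N} := by
    have hcl : ∀ x ∈ {x | x ∈ N}, ∀ y, SubStep Q R E x y → y ∈ {x | x ∈ N} :=
      fun x hx y hxy => h₄ x hx y ((mem_subSteps h).2 hxy)
    refine ⟨h₁, fun w ⟨ρ, hρ, hw, hv⟩ => h₃ ρ hρ w hw hv, hcl, fun x hx => ?_⟩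
    cases x with
    | var x => exact SN.var h
    | app f ts =>
      exact hbase (h₂ _ hx).1 fun j => hcl _ hx _ (.inr (.inr (.mk f ts j)))
  exact (hN.sn_of_over h (hQ _ fun _ ⟨t, ht⟩ => by
    obtain ⟨u, v, k₁, k₂, -⟩ := modStep_iff.1 ht
    rcases ReflTransGen.cases_head k₁ with rfl | ⟨c, h', -⟩
    · exact not_rStep_var h.goodR k₂
    · exact not_rStep_var h.goodE h') hbase hs).mono hQ

/-- `N` is everything reachable from `var 0` and the pieces, and `F` is everything reachable from
function symbols applied to elements of `N`; both are finite by `finite_reach`. The ranks are given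
by `stepRank`, and `B` lists the elements of `N ∪ F` that violate the restriction. -/
theorem exists_posCheck (h : System S R E) (hn : ¬ Loops S (Restr b R E) R E) :
    ∃ c, posCheck b (S, R, E) c = true := by
  classical
  set Q := Restr b R E with hQ
  set N : Set Term := {t | Reach Q R E (var 0) t} ∪
    ⋃ w ∈ {w | Piece R E w}, {t | Reach Q R E w t} with hNdef
  have hNfin : N.Finite := (finite_reach h hn (s := var 0) trivial).union
    ((finite_setOf_piece R E).biUnion fun w hw => finite_reach h hn (Piece.over h hw))
  have hNover : ∀ x ∈ N, x.Over S := by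
    rintro x (hx | hx)
    · exact SubStep.star_over h hx trivial
    · obtain ⟨w, hw, hwx⟩ := Set.mem_iUnion₂.1 hx
      exact SubStep.star_over h hwx (Piece.over h hw)
  have hNcl : ∀ x ∈ N, ∀ y, SubStep Q R E x y → y ∈ N := by
    rintro x (hx | hx) y hxy
    · exact .inl (ReflTransGen.tail hx hxy)
    · obtain ⟨w, hw, hwx⟩ := Set.mem_iUnion₂.1 hx
      exact .inr (Set.mem_biUnion hw (ReflTransGen.tail hwx hxy))
  have hAover : ∀ s ∈ appSet S N, s.Over S := by
    rintro _ ⟨n, f, ts, hf, hts, rfl⟩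
    exact ⟨hf, fun i => hNover _ (hts i)⟩
  set F : Set Term := ⋃ s ∈ appSet S N, {t | Reach Q R E s t} with hFdef
  have hFfin : F.Finite :=
    (appSet_finite S hNfin).biUnion fun s hs => finite_reach h hn (hAover s hs)
  have hFover : ∀ x ∈ F, x.Over S := by
    intro x hx
    obtain ⟨w, hw, hwx⟩ := Set.mem_iUnion₂.1 hx
    exact SubStep.star_over h hwx (hAover w hw)
  have hFcl : ∀ x ∈ F, ∀ y, SubStep Q R E x y → y ∈ F := by
    intro x hx y hxy
    obtain ⟨w, hw, hwx⟩ := Set.mem_iUnion₂.1 hx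
    exact Set.mem_biUnion hw (ReflTransGen.tail hwx hxy)
  have hWfin : (N ∪ F).Finite := hNfin.union hFfin
  have hred : ∀ w, ∃ k, ¬ Q w → ∃ u ∈ levels (eSteps E) k [w], eSteps R u ≠ [] := by
    intro w
    by_cases hw : Q w
    · exact ⟨0, fun h => absurd hw h⟩
    · obtain ⟨u, v, h₁, h₂⟩ := not_isNormalForm_iff.1 (Classical.not_imp.1 hw).2
      obtain ⟨k, hk⟩ := (mem_levels fun s t => mem_eSteps h.vars_subset').2 h₁
      exact ⟨k, fun _ => ⟨u, hk, List.ne_nil_of_mem ((mem_eSteps h.vars_subset).2 h₂)⟩⟩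
  choose k hk using hred
  set B : List (Term × ℕ) :=
    ((hWfin.subset (Set.sep_subset _ fun w => ¬ Q w)).toFinset.toList).map fun w => (w, k w)
    with hB
  have hmemB : ∀ p, p ∈ B ↔ (p.1 ∈ N ∪ F ∧ ¬ Q p.1) ∧ p.2 = k p.1 := by
    rintro ⟨w, l⟩
    simp only [hB, List.mem_map, Finset.mem_toList, Set.Finite.mem_toFinset, Set.mem_sep_iff,
      Prod.mk.injEq]
    constructor
    · rintro ⟨w, hw, rfl, rfl⟩
      exact ⟨hw, rfl⟩
    · rintro ⟨hw, rfl⟩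
      exact ⟨w, hw, rfl, rfl⟩
  -- Redexes in terms of `N ∪ F` have their arguments in `N ∪ F` again, so the list `B` is complete
  -- for all arguments that matter.
  have hal : ∀ w ∈ N ∪ F, alPos b B w = true → Q w := by
    intro w hw hal
    by_contra hcon
    have hb : b = true := (Classical.not_imp.1 hcon).1
    simp only [alPos, hb, Bool.not_true, Bool.false_or, Bool.not_eq_true', ← Bool.not_eq_true,
      List.any_eq_true, beqCode_iff, not_exists, not_and] at hal
    exact hal (w, k w) ((hmemB _).2 ⟨⟨hw, hcon⟩, rfl⟩) rfl
  have hWcl : ∀ x ∈ N ∪ F, ∀ y, SubStep Q R E x y → y ∈ N ∪ F := by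
    rintro x (hx | hx) y hxy
    · exact .inl (hNcl x hx y hxy)
    · exact .inr (hFcl x hx y hxy)
  have hstep : ∀ x ∈ N ∪ F, ∀ y ∈ steps R (alPos b B) x, RStep Q R x y := by
    intro x hx y hxy
    exact ((mem_steps h.vars_subset).1 hxy).mono fun w hw => hal w (mem_of_sub hWcl hx hw)
  set C : List (Term × ℕ) := hFfin.toFinset.toList.map fun t => (t, stepRank Q R E t) with hC
  have hmemC : ∀ p, p ∈ C ↔ p.1 ∈ F ∧ p.2 = stepRank Q R E p.1 := by
    rintro ⟨w, l⟩
    simp only [hC, List.mem_map, Finset.mem_toList, Set.Finite.mem_toFinset, Prod.mk.injEq]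
    constructor
    · rintro ⟨w, hw, rfl, rfl⟩
      exact ⟨hw, rfl⟩
    · rintro ⟨hw, rfl⟩
      exact ⟨w, hw, rfl, rfl⟩
  refine ⟨(hNfin.toFinset.toList, C, B), posCheck_iff_forall.2 ?_⟩
  simp only [Finset.mem_toList, Set.Finite.mem_toFinset]
  refine ⟨.inl .refl, hNover, fun ρ hρ w hw hv => ?_, fun x hx y hy => ?_, ?_, ?_, ?_, ?_⟩
  · exact .inr (Set.mem_biUnion (x := w) ⟨ρ, hρ, hw, hv⟩ .refl)
  · rcases List.mem_append.1 hy with hy | hy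
    · exact hNcl x hx y (.inl ((mem_eSteps h.vars_subset').1 hy))
    rcases List.mem_append.1 hy with hy | hy
    · exact hNcl x hx y (.inr (.inl (hstep x (.inl hx) y hy)))
    · exact hNcl x hx y (.inr (.inr (mem_args.1 hy)))
  · rintro ⟨n, f⟩ hf us hus
    obtain ⟨hlen, hmem⟩ := mem_tuples.1 hus
    simp only [Finset.mem_toList, Set.Finite.mem_toFinset] at hlen hmem
    subst hlen
    refine ⟨stepRank Q R E (mkApp f us),
      (hmemC (mkApp f us, _)).2 ⟨Set.mem_biUnion (x := mkApp f us) ?_ .refl, rfl⟩⟩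
    exact ⟨us.length, f, _, hf, fun i => hmem _ (List.get_mem _ _), rfl⟩
  · intro q hq t ht
    obtain ⟨h₁, h₂⟩ := (hmemC q).1 hq
    have hst : SubStep Q R E q.1 t := .inl ((mem_eSteps h.vars_subset').1 ht)
    exact ⟨_, h₂ ▸ stepRank_le h hn (hFover _ h₁) (.single hst),
      (hmemC _).2 ⟨hFcl _ h₁ _ hst, rfl⟩⟩
  · intro q hq t ht
    obtain ⟨h₁, h₂⟩ := (hmemC q).1 hq
    have hst := hstep q.1 (.inr h₁) t ht
    exact ⟨_, h₂ ▸ stepRank_lt h hn (hFover _ h₁) hst,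
      (hmemC _).2 ⟨hFcl _ h₁ _ (.inr (.inl hst)), rfl⟩⟩
  · intro q hq
    obtain ⟨h₁, h₂⟩ := (hmemB q).1 hq
    rw [h₂]
    exact hk q.1 h₁.2

/-- A list of `R`-irreducible terms closed under `E`-steps. -/
def NormalList (R E : List Rule) (A : List Term) : Prop :=
  ∀ w ∈ A, eSteps R w = [] ∧ ∀ w' ∈ eSteps E w, w' ∈ A

theorem negCheck_iff {a : Input} {c : Term × ℕ × List Term} :
    negCheck b a c = true ↔ c.1.Over a.1 ∧ NormalList a.2.1 a.2.2 c.2.2 ∧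
      ∃ v ∈ steps a.2.1 (alNeg b c.2.2) c.1,
        c.1 ∈ levels (subSteps a.2.1 a.2.2 (alNeg b c.2.2)) c.2.1 [v] := by
  simp [negCheck, NormalList, memCode_iff, ← symList_subset (S := a.1), List.all_eq_true,
    List.any_eq_true]

theorem NormalList.append {A A' : List Term} (hA : NormalList R E A) (hA' : NormalList R E A') :
    NormalList R E (A ++ A') := by
  intro w hw
  rcases List.mem_append.1 hw with hw | hw
  · exact ⟨(hA w hw).1, fun w' h => List.mem_append_left _ ((hA w hw).2 w' h)⟩
  · exact ⟨(hA' w hw).1, fun w' h => List.mem_append_right _ ((hA' w hw).2 w' h)⟩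

theorem alNeg_mono {A A' : List Term} (hA : A ⊆ A') (w : Term) :
    alNeg b A w = true → alNeg b A' w = true := by
  simp only [alNeg, Bool.or_eq_true, memCode_iff]
  exact Or.imp_right fun h => hA h

/-- A member of an `E`-closed list of `R`-irreducible terms is a normal form modulo `E`, so the
steps allowed by the certificate are genuine restricted steps. -/
theorem loops_of_negCheck (h : System S R E) {c : Term × ℕ × List Term}
    (hc : negCheck b (S, R, E) c = true) : Loops S (Restr b R E) R E := by
  obtain ⟨u, k, A⟩ := c
  obtain ⟨h₁, h₂, v, h₃, h₄⟩ := negCheck_iff.1 hc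
  simp only at h₁ h₂ h₃ h₄
  refine Loops.mono (Q := fun w => alNeg b A w = true) ?_
    ⟨u, v, h₁, (mem_steps h.vars_subset).1 h₃,
      (mem_levels fun s t => mem_subSteps h).1 ⟨k, h₄⟩⟩
  intro w hw hb
  simp only [alNeg, hb, Bool.not_true, Bool.false_or, memCode_iff] at hw
  by_contra hcon
  obtain ⟨u, v, k₁, k₂⟩ := not_isNormalForm_iff.1 hcon
  have hu : u ∈ A := by
    clear k₂
    induction k₁ with
    | refl => exact hw
    | tail _ h' ih => exact (h₂ _ ih).2 _ ((mem_eSteps h.vars_subset').2 h')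
  have := (mem_eSteps h.vars_subset).2 k₂
  rw [(h₂ u hu).1] at this
  simp at this

/-- With the empty system in place of `R` there is no step to start a loop, so `finite_reach`
applies to `E` alone. -/
theorem finite_eStar (h : System S R E) {s : Term} (hs : s.Over S) :
    {t | ReflTransGen (EStep E) s t}.Finite := by
  have hn : ¬ Loops S (fun _ => True) [] E := by
    rintro ⟨u, v, -, huv, -⟩
    clear hs
    induction huv with
    | root h' =>
      obtain ⟨ρ, hρ, -⟩ := h'
      simp at hρ
    | arg _ _ _ _ ih => exact ih
  exact (finite_reach h.nil hn hs).subset fun t ht => reach_of_eStar ht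

theorem exists_normalList (h : System S R E) {s : Term} (hs : s.Over S)
    (hn : IsNormalForm R E s) : ∃ A, NormalList R E A ∧ s ∈ A := by
  refine ⟨(finite_eStar h hs).toFinset.toList, fun w hw => ?_, by simp [ReflTransGen.refl]⟩
  simp only [Finset.mem_toList, Set.Finite.mem_toFinset, Set.mem_ofPred_eq] at hw ⊢
  refine ⟨List.eq_nil_iff_forall_not_mem.2 fun v hv => ?_, fun w' hw' => ?_⟩
  · exact not_isNormalForm_iff.2 ⟨w, v, hw, (mem_eSteps h.vars_subset).1 hv⟩ hn
  · exact hw.tail ((mem_eSteps h.vars_subset').1 hw')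

/-- A redex has finitely many arguments, and the terms reachable by `E` from each of them form a
finite list; concatenating these lists certifies all arguments at once. -/
theorem exists_normalList_of_rStep (h : System S R E) {s t : Term} (hs : s.Over S)
    (hst : RStep (Restr b R E) R s t) :
    ∃ A, NormalList R E A ∧ RStep (fun w => alNeg b A w = true) R s t := by
  induction hst with
  | @root s t h' =>
    obtain ⟨ρ, hρ, σ, h₁, h₂, h₃⟩ := h'
    cases b with
    | false =>
      exact ⟨[], fun w hw => by simp at hw, .root ⟨ρ, hρ, σ, h₁, h₂, fun w _ => by simp [alNeg]⟩⟩
    | true =>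
      have key : ∀ L : List Term, (∀ w ∈ L, w.Over S ∧ IsNormalForm R E w) →
          ∃ A, NormalList R E A ∧ L ⊆ A := by
        intro L
        induction L with
        | nil => exact fun _ => ⟨[], fun w hw => by simp at hw, by simp⟩
        | cons w L ih =>
          intro hL
          obtain ⟨A, hA, hLA⟩ := ih fun w hw => hL w (List.mem_cons_of_mem _ hw)
          obtain ⟨h₁, h₂⟩ := hL w List.mem_cons_self
          obtain ⟨A', hA', hw⟩ := exists_normalList h h₁ h₂
          refine ⟨A' ++ A, hA'.append hA, List.cons_subset.2 ⟨List.mem_append_left _ hw, ?_⟩⟩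
          exact fun w hw => List.mem_append_right _ (hLA hw)
      obtain ⟨A, hA, hsA⟩ := key s.args fun w hw =>
        ⟨hs.child (mem_args.1 hw), h₃ w (mem_args.1 hw) rfl⟩
      refine ⟨A, hA, .root ⟨ρ, hρ, σ, h₁, h₂, fun w hw => ?_⟩⟩
      simpa [alNeg] using hsA (mem_args.2 hw)
  | arg f ts i _ ih =>
    obtain ⟨A, hA, h'⟩ := ih (hs.2 i)
    exact ⟨A, hA, .arg f ts i h'⟩

theorem exists_normalList_of_reach (h : System S R E) {s t : Term} (hs : s.Over S)
    (hst : Reach (Restr b R E) R E s t) :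
    ∃ A, NormalList R E A ∧ Reach (fun w => alNeg b A w = true) R E s t := by
  induction hst with
  | refl => exact ⟨[], fun w hw => by simp at hw, .refl⟩
  | @tail u v hsu huv ih =>
    obtain ⟨A, hA, hsu'⟩ := ih
    rcases huv with h' | h' | h'
    · exact ⟨A, hA, hsu'.tail (.inl h')⟩
    · obtain ⟨A', hA', h''⟩ := exists_normalList_of_rStep h (SubStep.star_over h hsu hs) h'
      refine ⟨A ++ A', hA.append hA', ReflTransGen.tail (Reach.mono
        (alNeg_mono (List.subset_append_left _ _)) hsu') (.inr (.inl (h''.mono fun w _ =>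
          alNeg_mono (List.subset_append_right _ _) w)))⟩
    · exact ⟨A, hA, hsu'.tail (.inr (.inr h'))⟩

theorem exists_negCheck (h : System S R E) (hl : Loops S (Restr b R E) R E) :
    ∃ c, negCheck b (S, R, E) c = true := by
  obtain ⟨u, v, hu, huv, hvu⟩ := hl
  obtain ⟨A, hA, huv'⟩ := exists_normalList_of_rStep h hu huv
  obtain ⟨A', hA', hvu'⟩ := exists_normalList_of_reach h (huv.over h.goodR hu) hvu
  have huv'' : RStep (fun w => alNeg b (A ++ A') w = true) R u v :=
    huv'.mono fun w _ => alNeg_mono (List.subset_append_left _ _) w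
  have hvu'' : Reach (fun w => alNeg b (A ++ A') w = true) R E v u :=
    Reach.mono (alNeg_mono (List.subset_append_right _ _)) hvu'
  obtain ⟨k, hk⟩ := (mem_levels fun s t => mem_subSteps h).2 hvu''
  exact ⟨(u, k, A ++ A'), negCheck_iff.2 ⟨hu, hA.append hA', v,
    (mem_steps h.vars_subset).2 huv'', hk⟩⟩

end

/-! ### Decidability -/

/-- Strong normalization of restricted rewriting is decidable for right-shallow right-linear
systems modulo permutative theories. -/
theorem computablePred_sn (b : Bool) : ComputablePred fun a : Input =>
    System a.1 a.2.1 a.2.2 ∧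
      ∀ s : Term, s.Over a.1 → SN (Restr b a.2.1 a.2.2) a.2.1 a.2.2 s := by
  -- Post's theorem. Including `System` in the predicate makes the two searches complementary on all
  -- inputs; both can test it, since it is primitive recursive.
  rw [ComputablePred.computable_iff_re_compl_re']
  constructor
  · have := rePred_exists (p := fun a c => sysCheck a && posCheck b a c)
      (Primrec.and.comp (primrec_sysCheck.comp .fst) (primrec_posCheck b))
    refine this.of_eq fun ⟨S, R, E⟩ => ?_
    simp only [Bool.and_eq_true, sysCheck_iff, exists_and_left]
    refine and_congr_right fun h => ⟨fun ⟨c, hc⟩ s => sn_of_posCheck h hc, fun hs => ?_⟩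
    exact exists_posCheck h (not_loops_of_sn h hs)
  · have := rePred_exists (p := fun a c => !sysCheck a || negCheck b a c)
      (Primrec.or.comp (Primrec.not.comp (primrec_sysCheck.comp .fst)) (primrec_negCheck b))
    refine this.of_eq fun ⟨S, R, E⟩ => ?_
    simp only [Bool.or_eq_true, Bool.not_eq_true', ← Bool.not_eq_true, sysCheck_iff]
    constructor
    · rintro ⟨c, hc⟩ ⟨h, hs⟩
      exact not_loops_of_sn h hs (loops_of_negCheck h (hc.resolve_left (not_not.2 h)))
    · intro hn
      by_cases h : System S R E
      · have hl : Loops S (Restr b R E) R E := by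
          by_contra hcon
          exact hn ⟨h, fun s hs => sn_of_not_loops h hcon hs⟩
        obtain ⟨c, hc⟩ := exists_negCheck h hl
        exact ⟨c, .inr hc⟩
      -- When `System` fails, the test succeeds whatever the certificate is.
      · exact ⟨(var 0, 0, []), .inl h⟩

end RewritingModulo

theorem theorem6p4 :
    (∃ f : List (ℕ × ℕ) × List RewritingModulo.Rule × List RewritingModulo.Rule → Bool,
      Computable f ∧
        ∀ (S : List (ℕ × ℕ)) (R E : List RewritingModulo.Rule),
          RewritingModulo.IsTRS S R → RewritingModulo.RightShallow R →
          RewritingModulo.RightLinear R → RewritingModulo.IsPermutativeTheory S E →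
            (f (S, R, E) = true ↔ RewritingModulo.Terminating S R E)) ∧
    (∃ f : List (ℕ × ℕ) × List RewritingModulo.Rule × List RewritingModulo.Rule → Bool,
      Computable f ∧
        ∀ (S : List (ℕ × ℕ)) (R E : List RewritingModulo.Rule),
          RewritingModulo.IsTRS S R → RewritingModulo.RightShallow R →
          RewritingModulo.RightLinear R → RewritingModulo.IsPermutativeTheory S E →
            (f (S, R, E) = true ↔ RewritingModulo.InnermostTerminating S R E)) := by
  constructor
  · obtain ⟨_, hf⟩ := RewritingModulo.computablePred_sn false
    refine ⟨_, hf, fun S R E hR hs hl hE => ?_⟩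
    rw [decide_eq_true_iff, RewritingModulo.terminating_iff]
    -- The decided predicate has `System` as an extra conjunct, which the hypotheses supply.
    exact and_iff_right (RewritingModulo.System.of_permutative hR hs hl hE)
  · obtain ⟨_, hf⟩ := RewritingModulo.computablePred_sn true
    refine ⟨_, hf, fun S R E hR hs hl hE => ?_⟩
    rw [decide_eq_true_iff, RewritingModulo.innermostTerminating_iff]
    exact and_iff_right (RewritingModulo.System.of_permutative hR hs hl hE)
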